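/- Let $d\ge 0$ and let $n,p,k$ be integers with $p,k\ge 1$, $p+k\le n$ and $p\le n/2+1$. Let $Z_i=(X_i,Y_i)$, $1\le i\le n$, be independent random variables with values in $\mathbb{R}^d\times\{0,1\}$ and common law $\nu$, and assume that distance ties have probability zero: if $X,X',X''$ are independent with the law of $X_1$, then $\|X'-X\|\neq\|X''-X\|$ almost surely ($\|\cdot\|$ the Euclidean norm). For $e\subset\{1,\dots,n\}$ with $|e|\ge k$, let $\hat f_k(Z^e;\cdot):\mathbb{R}^d\to\{0,1\}$ be the $k$-nearest neighbour classifier built from $(Z_i)_{i\in e}$: $\hat f_k(Z^e;x)=1$ if $\frac1k\sum_{i\in V_k^e(x)}Y_i>\frac12$ and $\hat f_k(Z^e;x)=0$ otherwise, where $V_k^e(x)$ is the set of the indices of the $k$ nearest neighbours of $x$ among $(X_i)_{i\in e}$ (points at equal distance being ordered by index). For measurable $f:\mathbb{R}^d\to\{0,1\}$ put $L(f)=\nu\{(x,y): f(x)\ne y\}$. Let $R(\hat f_k)=\mathbb{E}\big[L\big(\hat f_k(Z^{\{1,\dots,n\}};\cdot)\big)\big]$ be the risk, and let $$\widehat R_p(\hat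 f_k)=\binom np^{-1}\sum_{e\subset\{1,\dots,n\},\ |e|=n-p}\ \frac1p\sum_{i\notin e}\mathbf 1_{\{\hat f_k(Z^e;X_i)\ne Y_i\}}$$ be the leave-$p$-out estimator. Let $\gamma_d$ be the constant of Stone's lemma, i.e. the least $\gamma$ such that in every finite family of points of $\mathbb{R}^d$ without distance ties (the distances from any one of the points to the others are pairwise distinct) and for every integer $k'\ge 1$, each point is one of the $k'$ nearest neighbours (among the remaining points) of at most $k'\gamma$ of the other points. Let $\kappa=\frac{\sqrt e}{2(\sqrt e-1)}\le 1.271$ and $$C_1=2+16\gamma_d,\qquad C_2=4\gamma_d\sqrt{2\kappa},\qquad \Delta=4\sqrt e\,\max\big(C_2,\sqrt{C_1}\big).$$ Then for every $x>0$ there is an event of probability at least $1-2e^{-x}$ on which $$\big|R(\hat f_k)-\widehat R_p(\hat f_k)\big|\le\sqrt{\frac{\Delta^2k^2}{n-p+1}\,x}+\frac{4}{\sqrt{2\pi}}\,\frac{p\sqrt k}{n}.$$ -/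

import Mathlib

open MeasureTheory ProbabilityTheory

namespace KNN

/-- The feature space `ℝ^d` with its Euclidean norm. -/
abbrev Feature (d : ℕ) : Type := EuclideanSpace ℝ (Fin d)

/-- A labelled observation `(x, y)`; the labels `0` and `1` are `false` and `true`. -/
abbrev Obs (d : ℕ) : Type := Feature d × Bool

/-- `Closer x q j i`: the point `x j` comes before `x i` when the points are sorted by increasing
distance to `q` (points at equal distance are sorted by index, so that this is a total order on
the indices). -/
def Closer {d n : ℕ} (x : Fin n → Feature d) (q : Feature d) (j i : Fin n) : Prop :=
  dist (x j) q < dist (x i) q ∨ (dist (x j) q = dist (x i) q ∧ j < i)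

open scoped Classical in
/-- The set of indices of the `k` nearest neighbours of `q` among the points `x i`, `i ∈ e`:
the indices in `e` that are preceded by fewer than `k` indices of `e`. -/
noncomputable def nearest {d n : ℕ} (x : Fin n → Feature d) (e : Finset (Fin n)) (k : ℕ)
    (q : Feature d) : Finset (Fin n) :=
  e.filter fun i => (e.filter fun j => Closer x q j i).card < k

/-- The `k`-nearest neighbour classifier built from the subsample `(z i)`, `i ∈ e`: it answers `1`
if more than half of the labels of the `k` nearest neighbours of `q` are `1`, and `0` otherwise. -/
noncomputable def classifier {d n : ℕ} (k : ℕ) (z : Fin n → Obs d) (e : Finset (Fin n))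
    (q : Feature d) : Bool :=
  decide ((1 / 2 : ℝ) <
    (1 / (k : ℝ)) * ∑ i ∈ nearest (fun i => (z i).1) e k q, if (z i).2 = true then (1 : ℝ) else 0)

/-- The classification error `L(f)` of `f`, the probability that `f X ≠ Y` when `(X, Y)` has
law `ν`. -/
noncomputable def classificationError {d : ℕ} (ν : Measure (Obs d)) (f : Feature d → Bool) : ℝ :=
  ν.real {z | f z.1 ≠ z.2}

/-- The risk of the `k`-nearest neighbour classifier: the expectation, over the sample `Z`, of the
classification error of the classifier built from the whole sample. -/
noncomputable def risk {d n : ℕ} {Ω : Type*} [MeasurableSpace Ω] (P : Measure Ω)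
    (ν : Measure (Obs d)) (Z : Fin n → Ω → Obs d) (k : ℕ) : ℝ :=
  ∫ ω, classificationError ν (classifier k (fun i => Z i ω) Finset.univ) ∂P

/-- The leave-`p`-out estimator of the risk of the `k`-nearest neighbour classifier. -/
noncomputable def leavePOut {d n : ℕ} (p k : ℕ) (z : Fin n → Obs d) : ℝ :=
  ((n.choose p : ℕ) : ℝ)⁻¹ *
    ∑ e ∈ Finset.powersetCard (n - p) (Finset.univ : Finset (Fin n)),
      (1 / (p : ℝ)) * ∑ i ∈ eᶜ, if classifier k z e (z i).1 ≠ (z i).2 then (1 : ℝ) else 0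

/-- Distance ties have probability zero: if `X, X₁, X₂` are independent with law `μ`, then almost
surely `X₁` and `X₂` are not at the same distance from `X`. -/
def NoDistanceTies {d : ℕ} (μ : Measure (Feature d)) : Prop :=
  ∀ᵐ t ∂(μ.prod (μ.prod μ)), dist t.2.1 t.1 ≠ dist t.2.2 t.1

open scoped Classical in
/-- `γ` is an admissible constant in Stone's lemma in `ℝ^d`: in every finite family of points
without distance ties, and for every `k ≥ 1`, each point is one of the `k` nearest neighbours (among
the remaining points) of at most `k * γ` of the other points. -/
def StoneBound (d : ℕ) (γ : ℝ) : Prop :=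
  ∀ (m : ℕ) (x : Fin m → Feature d),
    (∀ i j l : Fin m, i ≠ j → i ≠ l → j ≠ l → dist (x j) (x i) ≠ dist (x l) (x i)) →
    ∀ k : ℕ, 1 ≤ k → ∀ j : Fin m,
      (((Finset.univ.filter fun i : Fin m =>
        i ≠ j ∧ j ∈ nearest x (Finset.univ.erase i) k (x i)).card : ℕ) : ℝ) ≤ k * γ

/-- The constant `γ_d` of Stone's lemma: the least admissible one. -/
noncomputable def stoneConst (d : ℕ) : ℝ := sInf {γ : ℝ | StoneBound d γ}

/-- The universal constant `κ ≤ 1.271` of the generalized Efron-Stein inequality. -/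
noncomputable def kappa : ℝ := √(Real.exp 1) / (2 * (√(Real.exp 1) - 1))

noncomputable def constC₁ (d : ℕ) : ℝ := 2 + 16 * stoneConst d

noncomputable def constC₂ (d : ℕ) : ℝ := 4 * stoneConst d * √(2 * kappa)

/-- The constant `Δ = 4 √e max (C₂, √C₁)`, which depends on `d` only. -/
noncomputable def constDelta (d : ℕ) : ℝ :=
  4 * √(Real.exp 1) * max (constC₂ d) √(constC₁ d)

end KNN

/-! The deviation splits into a fluctuation of the leave-p-out estimator about its mean and a bias,
the gap between that mean and the risk.

Fluctuation. The estimator is a normalised sum, over the subsets `v` of size n - p + 1, of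
leave-one-out errors (`sum_sum_compl_eq_sum_sum_erase`). Replacing the j-th observation affects only
those `v` that contain j. Inside such a `v` it can change the loss at j itself and at the points
that have j as a neighbour before or after the replacement, hence by Stone's lemma at most 1 + 2kγ
losses. Counting the sets `v` that contain j gives bounded differences (1 + 2kγ)/n
(`abs_leavePOut_sub_le`). Stone's lemma needs tie-free samples, so McDiarmid's inequality is proved
for differences controlled only on a set of full measure (`integral_exp_le_of_boundedDifferences`).
The constant Δ leaves ample room.

Bias. Without ties, breaking ties by index is immaterial, so expected losses depend only on the size
of the training sample, and the mean of the estimator is the risk with n - p observations. To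
compare sizes m and m - 1, average over the deleted point: m times the gap is at most the expected
number of points whose deletion flips the vote at an independent query. Such a point is one of the k
nearest neighbours, and the other k - 1 carry exactly ⌊k/2⌋ ones
(`balanced_of_classifier_erase_ne`). With the (k+1)-th neighbour fixed, those k - 1 observations are
i.i.d. draws conditioned to fall in a ball, so the balance has at most the maximal probability of a
binomial atom, bounded by `tieProb k`, which is at most 1/√k unless k = 2. The one-step gap is then
at most √k/m. Telescoping from n to n - p costs ∑ 1/(n - j) ≤ 3p/(2n), and 3/2 ≤ 4/√(2π). For k = 2
a direct union bound is used instead. -/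

namespace KNN

/-! ### Ranks in a finite set ordered by an injective key. -/

section Rank

variable {ι α : Type*} [LinearOrder α]

/-- The number of elements of `e` with a key smaller than that of `i`. -/
def keyRank (e : Finset ι) (f : ι → α) (i : ι) : ℕ := (e.filter fun j => f j < f i).card

lemma keyRank_lt_card {e : Finset ι} {f : ι → α} {i : ι} (hi : i ∈ e) :
    keyRank e f i < e.card := by
  refine Finset.card_lt_card ((Finset.filter_ssubset).2 ⟨i, hi, lt_irrefl _⟩)

lemma keyRank_le_of_le {e : Finset ι} {f : ι → α} {i j : ι} (h : f i ≤ f j) :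
    keyRank e f i ≤ keyRank e f j :=
  Finset.card_le_card fun l hl => by
    simp only [Finset.mem_filter] at hl ⊢
    exact ⟨hl.1, hl.2.trans_le h⟩

lemma keyRank_lt_of_lt {e : Finset ι} {f : ι → α} {i j : ι} (hi : i ∈ e) (h : f i < f j) :
    keyRank e f i < keyRank e f j := by
  refine Finset.card_lt_card ?_
  rw [Finset.ssubset_iff_of_subset]
  · exact ⟨i, by simp [hi, h], by simp⟩
  · intro l hl
    simp only [Finset.mem_filter] at hl ⊢
    exact ⟨hl.1, hl.2.trans h⟩

lemma keyRank_lt_iff {e : Finset ι} {f : ι → α} {i j : ι} (hi : i ∈ e) :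
    keyRank e f i < keyRank e f j ↔ f i < f j := by
  refine ⟨fun h => ?_, keyRank_lt_of_lt hi⟩
  by_contra hc
  exact absurd (keyRank_le_of_le (e := e) (not_lt.1 hc)) (not_le.2 h)

lemma keyRank_injOn {e : Finset ι} {f : ι → α} (hf : Function.Injective f) :
    Set.InjOn (keyRank e f) e := by
  intro i hi j hj h
  by_contra hne
  rcases lt_or_gt_of_ne (hf.ne hne) with h' | h'
  · exact absurd h (keyRank_lt_of_lt hi h').ne
  · exact absurd h (keyRank_lt_of_lt hj h').ne'

lemma image_keyRank {e : Finset ι} {f : ι → α} (hf : Function.Injective f) :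
    e.image (keyRank e f) = Finset.range e.card := by
  refine Finset.eq_of_subset_of_card_le ?_ ?_
  · intro r hr
    obtain ⟨i, hi, rfl⟩ := Finset.mem_image.1 hr
    exact Finset.mem_range.2 (keyRank_lt_card hi)
  · rw [Finset.card_image_of_injOn (keyRank_injOn hf), Finset.card_range]

lemma exists_keyRank_eq {e : Finset ι} {f : ι → α} (hf : Function.Injective f) {r : ℕ}
    (hr : r < e.card) : ∃ i ∈ e, keyRank e f i = r := by
  have : r ∈ e.image (keyRank e f) := by rw [image_keyRank hf]; exact Finset.mem_range.2 hr
  simpa using this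

lemma card_filter_keyRank_lt {e : Finset ι} {f : ι → α} (hf : Function.Injective f) (k : ℕ) :
    (e.filter fun i => keyRank e f i < k).card = min k e.card := by
  have h : (e.filter fun i => keyRank e f i < k).image (keyRank e f)
      = (Finset.range e.card).filter (· < k) := by
    rw [← image_keyRank hf, Finset.filter_image]
  rw [← Finset.card_image_of_injOn ((keyRank_injOn hf).mono (Finset.filter_subset _ _)), h]
  have : (Finset.range e.card).filter (· < k) = Finset.range (min k e.card) := by
    ext; simp [and_comm]
  rw [this, Finset.card_range]

end Rank

/-! ### Nearest neighbours and votes: restriction and relabelling. -/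

variable {d n m : ℕ}

/-- The key by which the points are sorted: the distance to the query, then the index. -/
noncomputable def distKey (x : Fin n → Feature d) (q : Feature d) (i : Fin n) : ℝ ×ₗ Fin n :=
  toLex (dist (x i) q, i)

lemma closer_iff_distKey {x : Fin n → Feature d} {q : Feature d} {j i : Fin n} :
    Closer x q j i ↔ distKey x q j < distKey x q i := by
  simp [Closer, distKey, Prod.Lex.toLex_lt_toLex]

lemma distKey_injective (x : Fin n → Feature d) (q : Feature d) :
    Function.Injective (distKey x q) := by
  intro i j h
  have h' := congrArg ofLex h
  simp only [distKey, ofLex_toLex, Prod.mk.injEq] at h'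
  exact h'.2

lemma nearest_eq (x : Fin n → Feature d) (e : Finset (Fin n)) (k : ℕ) (q : Feature d) :
    nearest x e k q = e.filter fun i => keyRank e (distKey x q) i < k := by
  classical
  unfold nearest keyRank
  simp only [closer_iff_distKey]

lemma mem_nearest {x : Fin n → Feature d} {e : Finset (Fin n)} {k : ℕ} {q : Feature d}
    {i : Fin n} : i ∈ nearest x e k q ↔ i ∈ e ∧ keyRank e (distKey x q) i < k := by
  rw [nearest_eq, Finset.mem_filter]

lemma nearest_subset (x : Fin n → Feature d) (e : Finset (Fin n)) (k : ℕ) (q : Feature d) :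
    nearest x e k q ⊆ e := by
  rw [nearest_eq]; exact Finset.filter_subset _ _

lemma card_nearest (x : Fin n → Feature d) (e : Finset (Fin n)) (k : ℕ) (q : Feature d) :
    (nearest x e k q).card = min k e.card := by
  rw [nearest_eq, card_filter_keyRank_lt (distKey_injective x q)]

/-- Points that are not among the nearest ones may be discarded. -/
lemma nearest_eq_of_subset {x : Fin n → Feature d} {e e' : Finset (Fin n)} {k : ℕ}
    {q : Feature d} (h₁ : nearest x e k q ⊆ e') (h₂ : e' ⊆ e) :
    nearest x e' k q = nearest x e k q := by
  ext i
  rw [mem_nearest]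
  constructor
  · rintro ⟨hi, hr⟩
    by_contra hc
    have hrank : k ≤ keyRank e (distKey x q) i := by
      by_contra hlt
      exact hc (mem_nearest.2 ⟨h₂ hi, not_le.1 hlt⟩)
    have hcard : (nearest x e k q).card = k := by
      rw [card_nearest]
      exact min_eq_left (hrank.trans (keyRank_lt_card (h₂ hi)).le)
    -- Outside the k nearest in `e`, the index `i` is preceded by all k of them, and they survive in
    -- `e'`; so its rank there is still at least k.
    have hsub : nearest x e k q ⊆ e'.filter fun j => distKey x q j < distKey x q i := by
      intro l hl
      refine Finset.mem_filter.2 ⟨h₁ hl, ?_⟩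
      have hl' := mem_nearest.1 hl
      exact (keyRank_lt_iff hl'.1).1 (hl'.2.trans_le hrank)
    have := Finset.card_le_card hsub
    rw [hcard] at this
    exact absurd hr (not_lt.2 this)
  · intro hi
    refine ⟨h₁ hi, lt_of_le_of_lt ?_ (mem_nearest.1 hi).2⟩
    exact Finset.card_le_card (Finset.filter_subset_filter _ h₂)

lemma nearest_erase_of_notMem {x : Fin n → Feature d} {e : Finset (Fin n)} {k : ℕ}
    {q : Feature d} {j : Fin n} (h : j ∉ nearest x e k q) :
    nearest x (e.erase j) k q = nearest x e k q :=
  nearest_eq_of_subset (fun _ hi => Finset.mem_erase.2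
    ⟨fun hij => h (hij ▸ hi), nearest_subset _ _ _ _ hi⟩) (Finset.erase_subset _ _)

lemma nearest_congr {x x' : Fin n → Feature d} {e : Finset (Fin n)} (h : ∀ i ∈ e, x i = x' i)
    (k : ℕ) (q : Feature d) : nearest x e k q = nearest x' e k q := by
  have hk : ∀ i ∈ e, distKey x q i = distKey x' q i := fun i hi => by simp [distKey, h i hi]
  ext i
  simp only [mem_nearest]
  refine and_congr_right fun hi => ?_
  have : keyRank e (distKey x q) i = keyRank e (distKey x' q) i := by
    unfold keyRank
    congr 1
    refine Finset.filter_congr fun j hj => ?_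
    rw [hk j hj, hk i hi]
  rw [this]

/-- Ranks see only the order of the points of `e`, so it suffices that the renaming preserves this
order. Increasing renamings do so even with ties, arbitrary injective ones only when distances to
the query are distinct. -/
lemma nearest_map {φ : Fin m ↪ Fin n} {x : Fin n → Feature d} {e : Finset (Fin m)}
    {q : Feature d}
    (h : ∀ i ∈ e, ∀ j ∈ e, Closer (fun l => x (φ l)) q j i ↔ Closer x q (φ j) (φ i)) (k : ℕ) :
    nearest x (e.map φ) k q = (nearest (fun l => x (φ l)) e k q).map φ := by
  ext a
  simp only [Finset.mem_map, mem_nearest]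
  have key : ∀ i ∈ e, keyRank (e.map φ) (distKey x q) (φ i)
      = keyRank e (distKey (fun l => x (φ l)) q) i := by
    intro i hi
    unfold keyRank
    rw [Finset.filter_map, Finset.card_map]
    congr 1
    refine Finset.filter_congr fun j hj => ?_
    have := h i hi j hj
    rw [closer_iff_distKey, closer_iff_distKey] at this
    exact this.symm
  constructor
  · rintro ⟨⟨i, hi, rfl⟩, hr⟩
    exact ⟨i, ⟨hi, (key i hi) ▸ hr⟩, rfl⟩
  · rintro ⟨i, ⟨hi, hr⟩, rfl⟩
    exact ⟨⟨i, hi, rfl⟩, (key i hi).symm ▸ hr⟩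

lemma closer_comp_iff_of_strictMono {φ : Fin m → Fin n} (hφ : StrictMono φ)
    (x : Fin n → Feature d) (q : Feature d) (j i : Fin m) :
    Closer (fun l => x (φ l)) q j i ↔ Closer x q (φ j) (φ i) := by
  simp [Closer, hφ.lt_iff_lt]

lemma closer_comp_iff_of_ne {φ : Fin m → Fin n} {x : Fin n → Feature d} {q : Feature d}
    {j i : Fin m} (h : j ≠ i → dist (x (φ j)) q ≠ dist (x (φ i)) q) :
    Closer (fun l => x (φ l)) q j i ↔ Closer x q (φ j) (φ i) := by
  by_cases hji : j = i
  · subst hji; simp [Closer]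
  · simp [Closer, h hji]

lemma classifier_eq (k : ℕ) (z : Fin n → Obs d) (e : Finset (Fin n)) (q : Feature d) :
    classifier k z e q = decide ((1 / 2 : ℝ) < (1 / (k : ℝ)) *
      (((nearest (fun i => (z i).1) e k q).filter fun i => (z i).2 = true).card : ℝ)) := by
  unfold classifier
  rw [Finset.sum_boole]

lemma classifier_congr_nearest {k : ℕ} {z : Fin n → Obs d} {e e' : Finset (Fin n)}
    {q : Feature d} (h : nearest (fun i => (z i).1) e' k q = nearest (fun i => (z i).1) e k q) :
    classifier k z e' q = classifier k z e q := by
  rw [classifier_eq, classifier_eq, h]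

lemma classifier_congr {z z' : Fin n → Obs d} {e : Finset (Fin n)} (h : ∀ i ∈ e, z i = z' i)
    (k : ℕ) (q : Feature d) : classifier k z e q = classifier k z' e q := by
  have hn : nearest (fun i => (z i).1) e k q = nearest (fun i => (z' i).1) e k q :=
    nearest_congr (fun i hi => by rw [h i hi]) k q
  have hf : ((nearest (fun i => (z' i).1) e k q).filter fun i => (z i).2 = true)
      = (nearest (fun i => (z' i).1) e k q).filter fun i => (z' i).2 = true :=
    Finset.filter_congr fun i hi => by rw [h i (nearest_subset _ _ _ _ hi)]
  rw [classifier_eq, classifier_eq, hn, hf]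

lemma classifier_map {φ : Fin m ↪ Fin n} {z : Fin n → Obs d} {e : Finset (Fin m)}
    {q : Feature d}
    (h : ∀ i ∈ e, ∀ j ∈ e, Closer (fun l => (z (φ l)).1) q j i ↔
      Closer (fun l => (z l).1) q (φ j) (φ i)) (k : ℕ) :
    classifier k z (e.map φ) q = classifier k (fun l => z (φ l)) e q := by
  rw [classifier_eq, classifier_eq, nearest_map (x := fun l => (z l).1) h k, Finset.filter_map,
    Finset.card_map]
  rfl

/-- No point of the family is equidistant from two others. -/
def TieFree (x : Fin n → Feature d) : Prop :=
  ∀ i j l : Fin n, i ≠ j → i ≠ l → j ≠ l → dist (x j) (x i) ≠ dist (x l) (x i)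

/-! ### Stone's lemma by a covering of directions. -/

section Stone

/-- With unit vectors â and b̂, one has a - b = ‖a‖(â - b̂) - (‖b‖ - ‖a‖)b̂, whose norm is at most
‖a‖ + (‖b‖ - ‖a‖). In geometric terms: vectors at an angle of at most 60° are no further apart than
the longer one is long. -/
lemma norm_sub_le_of_norm_normalized_sub_le {E : Type*} [NormedAddCommGroup E]
    [NormedSpace ℝ E] {a b : E} (hab : ‖a‖ ≤ ‖b‖)
    (h : ‖‖a‖⁻¹ • a - ‖b‖⁻¹ • b‖ ≤ 1) : ‖a - b‖ ≤ ‖b‖ := by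
  by_cases ha : a = 0
  · simp [ha]
  have ha' : ‖a‖ ≠ 0 := norm_ne_zero_iff.2 ha
  have hb' : ‖b‖ ≠ 0 := ((norm_pos_iff.2 ha).trans_le hab).ne'
  have hdec : a - b = ‖a‖ • (‖a‖⁻¹ • a - ‖b‖⁻¹ • b) - (‖b‖ - ‖a‖) • (‖b‖⁻¹ • b) := by
    rw [smul_sub, smul_smul, mul_inv_cancel₀ ha', one_smul, sub_smul, smul_smul, smul_smul,
      mul_inv_cancel₀ hb', one_smul]
    abel
  have hu : ‖‖b‖⁻¹ • b‖ = 1 := by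
    rw [norm_smul, norm_inv, norm_norm, inv_mul_cancel₀ hb']
  rw [hdec]
  refine (norm_sub_le _ _).trans ?_
  rw [norm_smul, norm_smul, hu, norm_norm, Real.norm_of_nonneg (sub_nonneg.2 hab), mul_one]
  nlinarith [norm_nonneg a, norm_nonneg b]

/-- Stone's lemma: some constant is admissible. -/
theorem exists_stoneBound (d : ℕ) : ∃ γ : ℝ, StoneBound d γ := by
  classical
  obtain ⟨t, htfin, htcov⟩ := Metric.totallyBounded_iff.1
    (isCompact_closedBall (0 : Feature d) 1).totallyBounded (1 / 2) (by norm_num)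
  refine ⟨(htfin.toFinset.card : ℝ), fun m x hx k hk j => ?_⟩
  set G : Finset (Fin m) := Finset.univ.filter fun i : Fin m =>
    i ≠ j ∧ j ∈ nearest x (Finset.univ.erase i) k (x i) with hG
  let u : Fin m → Feature d := fun i => ‖x i - x j‖⁻¹ • (x i - x j)
  have hu : ∀ i, u i ∈ Metric.closedBall (0 : Feature d) 1 := by
    intro i
    simp only [u, mem_closedBall_zero_iff, norm_smul, norm_inv, norm_norm]
    exact inv_mul_le_one
  have hsub : G ⊆ htfin.toFinset.biUnion fun c => G.filter fun i => u i ∈ Metric.ball c (1 / 2) := by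
    intro i hi
    obtain ⟨c, hc, hic⟩ := Set.mem_iUnion₂.1 (htcov (hu i))
    exact Finset.mem_biUnion.2 ⟨c, by simpa using hc, Finset.mem_filter.2 ⟨hi, hic⟩⟩
  have hcone : ∀ c, (G.filter fun i => u i ∈ Metric.ball c (1 / 2)).card ≤ k := by
    intro c
    set K := G.filter fun i => u i ∈ Metric.ball c (1 / 2) with hK
    rcases K.eq_empty_or_nonempty with h0 | hne
    · simp [h0]
    -- Take the point of the cell furthest from `x j`. Every other point of the cell is closer to it
    -- than `x j` is, strictly by the absence of ties; since `j` is among its k nearest neighbours,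
    -- there are fewer than k such points.
    obtain ⟨i, hi, hmax⟩ := Finset.exists_max_image K (fun i => ‖x i - x j‖) hne
    have hiK := Finset.mem_filter.1 hi
    have hiG := (Finset.mem_filter.1 hiK.1).2
    have hlt : K.erase i ⊆ (Finset.univ.erase i).filter fun l =>
        distKey x (x i) l < distKey x (x i) j := by
      intro l hl
      obtain ⟨hli, hlK⟩ := Finset.mem_erase.1 hl
      have hlK' := Finset.mem_filter.1 hlK
      have hlG := (Finset.mem_filter.1 hlK'.1).2
      refine Finset.mem_filter.2 ⟨by simp [hli], closer_iff_distKey.1 (Or.inl ?_)⟩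
      refine lt_of_le_of_ne ?_ (hx i l j hli.symm hiG.1 hlG.1)
      have h1 : ‖u l - u i‖ ≤ 1 := by
        rw [← dist_eq_norm]
        refine (dist_triangle_right (u l) (u i) c).trans ?_
        have h1 := Metric.mem_ball.1 hlK'.2
        have h2 := Metric.mem_ball.1 hiK.2
        linarith
      have h2 := norm_sub_le_of_norm_normalized_sub_le (hmax l hlK) h1
      rw [dist_eq_norm, dist_comm, dist_eq_norm]
      simpa using h2
    have h1 := Finset.card_le_card hlt
    have h2 := (mem_nearest.1 hiG.2).2
    unfold keyRank at h2
    rw [Finset.card_erase_of_mem hi] at h1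
    omega
  have : G.card ≤ htfin.toFinset.card * k :=
    (Finset.card_le_card hsub).trans (Finset.card_biUnion_le_card_mul _ _ _ fun c _ => hcone c)
  rw [mul_comm]
  exact_mod_cast this

lemma StoneBound.nonneg {γ : ℝ} (h : StoneBound d γ) : 0 ≤ γ := by
  have := h 1 0 (fun i j _ hij => absurd (Subsingleton.elim i j) hij) 1 le_rfl 0
  simpa using (Nat.cast_nonneg _).trans this

lemma stoneConst_nonneg (d : ℕ) : 0 ≤ stoneConst d :=
  Real.sInf_nonneg fun _ h => StoneBound.nonneg h

theorem stoneBound_stoneConst (d : ℕ) : StoneBound d (stoneConst d) := by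
  intro m x hx k hk j
  have hk' : (0 : ℝ) < k := by exact_mod_cast hk
  rw [← div_le_iff₀' hk']
  refine le_csInf (exists_stoneBound d) fun γ hγ => ?_
  rw [div_le_iff₀' hk']
  exact hγ m x hx k hk j

open scoped Classical in
/-- Stone's lemma for the subfamily indexed by `v`. -/
theorem card_stone_le {x : Fin n → Feature d} (hx : TieFree x) {k : ℕ} (hk : 1 ≤ k)
    (v : Finset (Fin n)) {j : Fin n} (hj : j ∈ v) :
    (((v.filter fun i => i ≠ j ∧ j ∈ nearest x (v.erase i) k (x i)).card : ℕ) : ℝ)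
      ≤ k * stoneConst d := by
  let φ : Fin v.card ↪ Fin n := (v.orderEmbOfFin rfl).toEmbedding
  have hmono : StrictMono φ := (v.orderEmbOfFin rfl).strictMono
  have hv : Finset.univ.map φ = v := by
    ext a; rw [← Finset.mem_coe, ← Finset.mem_coe, Finset.coe_map, Finset.coe_univ, Set.image_univ]
    exact Set.ext_iff.1 (v.range_orderEmbOfFin rfl) a
  obtain ⟨j', -, rfl⟩ := Finset.mem_map.1 (hv.symm ▸ hj)
  have hst := stoneBound_stoneConst d v.card (fun l => x (φ l))
    (fun a b c hab hac hbc => hx _ _ _ (φ.injective.ne hab) (φ.injective.ne hac)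
      (φ.injective.ne hbc)) k hk j'
  refine le_trans (le_of_eq ?_) hst
  have h := Finset.filter_map (f := φ) (s := Finset.univ)
    (p := fun i => i ≠ φ j' ∧ φ j' ∈ nearest x (v.erase i) k (x i))
  rw [hv] at h
  rw [h, Finset.card_map]
  congr 2
  refine Finset.filter_congr fun i _ => ?_
  have herase : v.erase (φ i) = (Finset.univ.erase i).map φ := by rw [Finset.map_erase, hv]
  simp only [Function.comp_apply, φ.injective.ne_iff, herase,
    nearest_map (φ := φ) (x := x) (fun a _ b _ => closer_comp_iff_of_strictMono hmono x _ b a),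
    Finset.mem_map' φ]

end Stone

/-! ### McDiarmid's inequality on a set of full measure. -/

section BoundedDifferences

variable {α : Type*} [MeasurableSpace α] (ν : Measure α) [IsProbabilityMeasure ν]

lemma measurePreserving_finCons (n : ℕ) :
    MeasurePreserving (fun w : α × (Fin n → α) => (Fin.cons w.1 w.2 : Fin (n + 1) → α))
      (ν.prod (Measure.pi fun _ : Fin n => ν)) (Measure.pi fun _ : Fin (n + 1) => ν) := by
  have h := (measurePreserving_piFinSuccAbove (fun _ : Fin (n + 1) => ν) 0).symm
  convert h using 1
  funext w
  simp [MeasurableEquiv.piFinSuccAbove, Fin.insertNthEquiv]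

lemma integrable_of_abs_le {β : Type*} [MeasurableSpace β] {μ : Measure β}
    [IsProbabilityMeasure μ] {f : β → ℝ} (hf : Measurable f) {C : ℝ} (hC : ∀ z, |f z| ≤ C) :
    Integrable f μ :=
  Integrable.of_bound hf.aestronglyMeasurable C (Filter.Eventually.of_forall hC)

/-- Hoeffding's lemma for the centred function, which lies in [-c, c] because its mean averages
values within c of each one. Using an interval of length 2c loses a factor 4 in the variance proxy,
which the size of Δ absorbs. -/
lemma integral_exp_le_of_ae_abs_sub_le {h : α → ℝ} (hh : Measurable h) {C c : ℝ}
    (hC : ∀ t, |h t| ≤ C) (hc : ∀ᵐ t ∂ν, ∀ᵐ t' ∂ν, |h t - h t'| ≤ c) (s : ℝ) :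
    ∫ t, Real.exp (s * (h t - ∫ t', h t' ∂ν)) ∂ν ≤ Real.exp (c ^ 2 * s ^ 2 / 2) := by
  have hint : Integrable h ν := integrable_of_abs_le hh hC
  have hmem : ∀ᵐ t ∂ν, h t - ∫ t', h t' ∂ν ∈ Set.Icc (-c) c := by
    filter_upwards [hc] with t ht
    rw [Set.mem_Icc, ← abs_le]
    have h1 : h t - ∫ t', h t' ∂ν = ∫ t', (h t - h t') ∂ν := by
      rw [integral_sub (integrable_const _) hint]; simp
    rw [h1]
    have := norm_integral_le_of_norm_le_const (μ := ν) (f := fun t' => h t - h t') ht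
    simpa using this
  have hsub := hasSubgaussianMGF_of_mem_Icc_of_integral_eq_zero (μ := ν)
    (X := fun t => h t - ∫ t', h t' ∂ν) (by fun_prop) hmem
    (by rw [integral_sub hint (integrable_const _)]; simp)
  have := hsub.mgf_le s
  unfold mgf at this
  refine this.trans (le_of_eq ?_)
  congr 3
  simp only [NNReal.coe_pow, NNReal.coe_div, coe_nnnorm, NNReal.coe_ofNat, Real.norm_eq_abs,
    sub_neg_eq_add]
  rw [div_pow, sq_abs]; ring

/-- The exponential moment bound behind McDiarmid's inequality, for a function whose differences
are bounded on a set of full measure. -/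
theorem integral_exp_le_of_boundedDifferences {c : ℝ} (n : ℕ) (f : (Fin n → α) → ℝ)
    (hf : Measurable f) {C : ℝ} (hC : ∀ z, |f z| ≤ C) (G : Set (Fin n → α))
    (hG : ∀ᵐ z ∂(Measure.pi fun _ : Fin n => ν), z ∈ G)
    (hd : ∀ j, ∀ z ∈ G, ∀ z' ∈ G, (∀ l, l ≠ j → z l = z' l) → |f z - f z'| ≤ c) (s : ℝ) :
    ∫ z, Real.exp (s * (f z - ∫ z', f z' ∂(Measure.pi fun _ : Fin n => ν)))
      ∂(Measure.pi fun _ : Fin n => ν) ≤ Real.exp (n * c ^ 2 * s ^ 2 / 2) := by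
  induction n with
  | zero =>
    have hconst : ∀ z, f z = f Fin.elim0 := fun z => congrArg f (Subsingleton.elim _ _)
    simp [hconst]
  | succ n ih =>
    set π := Measure.pi fun _ : Fin n => ν with hπ
    have hcons := measurePreserving_finCons ν n
    set F : α × (Fin n → α) → ℝ := fun w => f (Fin.cons w.1 w.2) with hF
    have hFm : Measurable F := hf.comp hcons.measurable
    have hFint : Integrable F (ν.prod π) := integrable_of_abs_le hFm fun w => hC _
    have hcomp : ∀ φ : ℝ → ℝ, Measurable φ →
        ∫ z, φ (f z) ∂(Measure.pi fun _ : Fin (n + 1) => ν) = ∫ w, φ (F w) ∂(ν.prod π) := by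
      intro φ hφ
      rw [← hcons.map_eq]
      exact integral_map hcons.measurable.aemeasurable (hφ.comp hf).aestronglyMeasurable
    set g : (Fin n → α) → ℝ := fun z => ∫ t, F (t, z) ∂ν with hg
    have hgm : Measurable g := by
      have : StronglyMeasurable fun z => ∫ t, F (t, z) ∂ν :=
        hFm.stronglyMeasurable.integral_prod_left'
      exact this.measurable
    have hgC : ∀ z, |g z| ≤ C := fun z => by
      have := norm_integral_le_of_norm_le_const (μ := ν) (f := fun t => F (t, z)) (C := C)
        (Filter.Eventually.of_forall fun t => hC _)
      simpa using this
    have hmean : ∫ z, f z ∂(Measure.pi fun _ : Fin (n + 1) => ν) = ∫ z, g z ∂π := by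
      refine (hcomp id measurable_id).trans ?_
      exact integral_prod_symm _ hFint
    have hGae : ∀ᵐ z ∂π, ∀ᵐ t ∂ν, (Fin.cons t z : Fin (n + 1) → α) ∈ G := by
      have h1 : ∀ᵐ w ∂(ν.prod π), (Fin.cons w.1 w.2 : Fin (n + 1) → α) ∈ G :=
        hcons.quasiMeasurePreserving.ae hG
      have h2 : ∀ᵐ w ∂(π.prod ν), (Fin.cons w.2 w.1 : Fin (n + 1) → α) ∈ G :=
        (Measure.measurePreserving_swap (μ := π) (ν := ν)).quasiMeasurePreserving.ae h1
      exact Measure.ae_ae_of_ae_prod h2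
    -- The first coordinate is integrated out. A tail is good when almost every extension of it is
    -- in `G`; this is a full-measure condition by Fubini, and it suffices to bound the differences
    -- of the averages.
    have hih := ih g hgm hgC {z | ∀ᵐ t ∂ν, (Fin.cons t z : Fin (n + 1) → α) ∈ G} hGae (by
      intro j z hz z' hz' hzz'
      have h1 : g z - g z' = ∫ t, (F (t, z) - F (t, z')) ∂ν := by
        rw [integral_sub]
        · exact integrable_of_abs_le (hFm.comp measurable_prodMk_right) fun t => hC _
        · exact integrable_of_abs_le (hFm.comp measurable_prodMk_right) fun t => hC _
      rw [h1]
      have := norm_integral_le_of_norm_le_const (μ := ν) (f := fun t => F (t, z) - F (t, z'))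
        (C := c) (by
          filter_upwards [hz, hz'] with t ht ht'
          refine hd j.succ _ ht _ ht' fun l hl => ?_
          induction l using Fin.cases with
          | zero => simp
          | succ l => simpa using hzz' l fun h => hl (by rw [h]))
      simpa using this)
    have hexpint : Integrable (fun w => Real.exp (s * (F w - ∫ z, g z ∂π))) (ν.prod π) := by
      refine integrable_of_abs_le (C := Real.exp (|s| * (C + |∫ z, g z ∂π|))) (by fun_prop)
        fun w => ?_
      rw [abs_of_pos (Real.exp_pos _)]
      refine Real.exp_le_exp.2 ((le_abs_self _).trans ?_)
      rw [abs_mul]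
      exact mul_le_mul_of_nonneg_left ((abs_sub _ _).trans (by gcongr; exact hC _)) (abs_nonneg _)
    have hexpint' : Integrable (fun z => Real.exp (s * (g z - ∫ z, g z ∂π))) π := by
      refine integrable_of_abs_le (C := Real.exp (|s| * (C + |∫ z, g z ∂π|))) (by fun_prop)
        fun w => ?_
      rw [abs_of_pos (Real.exp_pos _)]
      refine Real.exp_le_exp.2 ((le_abs_self _).trans ?_)
      rw [abs_mul]
      exact mul_le_mul_of_nonneg_left ((abs_sub _ _).trans (by gcongr; exact hgC _))
        (abs_nonneg _)
    rw [hmean, hcomp (fun y => Real.exp (s * (y - ∫ z, g z ∂π))) (by fun_prop),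
      integral_prod_symm _ hexpint]
    calc ∫ z, ∫ t, Real.exp (s * (F (t, z) - ∫ z, g z ∂π)) ∂ν ∂π
        ≤ ∫ z, Real.exp (c ^ 2 * s ^ 2 / 2) * Real.exp (s * (g z - ∫ z, g z ∂π)) ∂π := by
          refine integral_mono_ae hexpint.integral_prod_right (hexpint'.const_mul _) ?_
          filter_upwards [hGae] with z hz
          have hbd := integral_exp_le_of_ae_abs_sub_le ν (h := fun t => F (t, z)) (c := c)
            (hFm.comp measurable_prodMk_right) (fun t => hC _) (by
              filter_upwards [hz] with t ht
              filter_upwards [hz] with t' ht'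
              refine hd 0 _ ht _ ht' fun l hl => ?_
              induction l using Fin.cases with
              | zero => exact absurd rfl hl
              | succ l => simp) s
          calc ∫ t, Real.exp (s * (F (t, z) - ∫ z, g z ∂π)) ∂ν
              = (∫ t, Real.exp (s * (F (t, z) - g z)) ∂ν)
                * Real.exp (s * (g z - ∫ z, g z ∂π)) := by
                rw [← integral_mul_const]
                refine integral_congr_ae (Filter.Eventually.of_forall fun t => ?_)
                simp only
                rw [← Real.exp_add]; ring_nf
            _ ≤ _ := mul_le_mul_of_nonneg_right hbd (Real.exp_pos _).le
      _ ≤ Real.exp (c ^ 2 * s ^ 2 / 2) * Real.exp (n * c ^ 2 * s ^ 2 / 2) := by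
          rw [integral_const_mul]
          exact mul_le_mul_of_nonneg_left hih (Real.exp_pos _).le
      _ = _ := by rw [← Real.exp_add]; push_cast; ring_nf

/-- McDiarmid's inequality, for a function whose differences are bounded on a set of full
measure. -/
theorem measureReal_abs_sub_integral_gt_le {c : ℝ} (n : ℕ) (f : (Fin n → α) → ℝ)
    (hf : Measurable f) {C : ℝ} (hC : ∀ z, |f z| ≤ C) (G : Set (Fin n → α))
    (hG : ∀ᵐ z ∂(Measure.pi fun _ : Fin n => ν), z ∈ G)
    (hd : ∀ j, ∀ z ∈ G, ∀ z' ∈ G, (∀ l, l ≠ j → z l = z' l) → |f z - f z'| ≤ c)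
    (hn : 0 < n) (hc : 0 < c) {x : ℝ} (hx : 0 ≤ x) :
    (Measure.pi fun _ : Fin n => ν).real
      {z | √(2 * n * c ^ 2 * x) < |f z - ∫ z', f z' ∂(Measure.pi fun _ : Fin n => ν)|}
      ≤ 2 * Real.exp (-x) := by
  set π := Measure.pi fun _ : Fin n => ν
  set v : NNReal := ⟨n * c ^ 2, by positivity⟩ with hv
  have hv' : (v : ℝ) = n * c ^ 2 := rfl
  have hvpos : 0 < (v : ℝ) := by rw [hv']; positivity
  have hsub : HasSubgaussianMGF (fun z => f z - ∫ z', f z' ∂π) v π := by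
    refine ⟨fun s => ?_, fun s => ?_⟩
    · refine integrable_of_abs_le (C := Real.exp (|s| * (C + |∫ z, f z ∂π|))) (by fun_prop)
        fun w => ?_
      rw [abs_of_pos (Real.exp_pos _)]
      refine Real.exp_le_exp.2 ((le_abs_self _).trans ?_)
      rw [abs_mul]
      exact mul_le_mul_of_nonneg_left ((abs_sub _ _).trans (by gcongr; exact hC _)) (abs_nonneg _)
    · exact integral_exp_le_of_boundedDifferences ν n f hf hC G hG hd s
  -- The level at which the sub-Gaussian tail exp(-ε²/(2v)), with v = nc², equals exp(-x).
  set ε := √(2 * n * c ^ 2 * x) with hε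
  have hval : Real.exp (-ε ^ 2 / (2 * v)) = Real.exp (-x) := by
    congr 1
    rw [hε, Real.sq_sqrt (by positivity), hv']
    field_simp
  have h1 := hsub.measure_ge_le (Real.sqrt_nonneg _ : 0 ≤ ε)
  have h2 := hsub.neg.measure_ge_le (Real.sqrt_nonneg _ : 0 ≤ ε)
  rw [hval] at h1 h2
  refine (measureReal_mono (s₂ := {z | ε ≤ f z - ∫ z', f z' ∂π} ∪
    {z | ε ≤ (-fun z => f z - ∫ z', f z' ∂π) z}) ?_).trans
    ((measureReal_union_le _ _).trans (by linarith))
  intro z hz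
  rcases lt_abs.1 hz.out with h | h
  · exact Or.inl h.le
  · exact Or.inr h.le

end BoundedDifferences

/-! ### Bounded differences of the leave-p-out estimator. -/

/-- The loss at the `i`-th observation of the classifier built from the subsample `e`. -/
noncomputable def loss (k : ℕ) (z : Fin n → Obs d) (e : Finset (Fin n)) (i : Fin n) : ℝ :=
  if classifier k z e (z i).1 ≠ (z i).2 then 1 else 0

lemma loss_nonneg (k : ℕ) (z : Fin n → Obs d) (e : Finset (Fin n)) (i : Fin n) :
    0 ≤ loss k z e i := by
  unfold loss; split_ifs <;> norm_num

lemma loss_le_one (k : ℕ) (z : Fin n → Obs d) (e : Finset (Fin n)) (i : Fin n) :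
    loss k z e i ≤ 1 := by
  unfold loss; split_ifs <;> norm_num

lemma abs_loss_sub_le_one (k : ℕ) {z z' : Fin n → Obs d} {e e' : Finset (Fin n)} {i i' : Fin n} :
    |loss k z e i - loss k z' e' i'| ≤ 1 := by
  rw [abs_le]
  constructor <;> linarith [loss_nonneg k z e i, loss_le_one k z e i, loss_nonneg k z' e' i',
    loss_le_one k z' e' i']

lemma leavePOut_eq_sum_loss (p k : ℕ) (z : Fin n → Obs d) :
    leavePOut p k z = ((n.choose p : ℝ) * p)⁻¹ *
      ∑ e ∈ Finset.powersetCard (n - p) (Finset.univ : Finset (Fin n)), ∑ i ∈ eᶜ, loss k z e i := by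
  unfold leavePOut
  rw [← Finset.mul_sum, mul_inv, mul_assoc, one_div]
  rfl

/-- The leave-`p`-out estimator is an average of leave-one-out estimators. -/
lemma sum_sum_compl_eq_sum_sum_erase (m : ℕ) (g : Finset (Fin n) → Fin n → ℝ) :
    ∑ e ∈ Finset.powersetCard m (Finset.univ : Finset (Fin n)), ∑ i ∈ eᶜ, g e i =
      ∑ v ∈ Finset.powersetCard (m + 1) (Finset.univ : Finset (Fin n)),
        ∑ i ∈ v, g (v.erase i) i := by
  rw [Finset.sum_sigma', Finset.sum_sigma']
  refine Finset.sum_bij' (fun a _ => ⟨insert a.2 a.1, a.2⟩) (fun a _ => ⟨a.1.erase a.2, a.2⟩)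
    ?_ ?_ ?_ ?_ ?_
  · rintro ⟨e, i⟩ h
    simp only [Finset.mem_sigma, Finset.mem_powersetCard_univ, Finset.mem_compl] at h ⊢
    exact ⟨by rw [Finset.card_insert_of_notMem h.2, h.1], Finset.mem_insert_self _ _⟩
  · rintro ⟨v, i⟩ h
    simp only [Finset.mem_sigma, Finset.mem_powersetCard_univ, Finset.mem_compl] at h ⊢
    exact ⟨by rw [Finset.card_erase_of_mem h.2, h.1]; rfl, Finset.notMem_erase _ _⟩
  · rintro ⟨e, i⟩ h
    simp only [Finset.mem_sigma, Finset.mem_compl] at h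
    simp [Finset.erase_insert h.2]
  · rintro ⟨v, i⟩ h
    simp only [Finset.mem_sigma] at h
    simp [Finset.insert_erase h.2]
  · rintro ⟨e, i⟩ h
    simp only [Finset.mem_sigma, Finset.mem_compl] at h
    simp [Finset.erase_insert h.2]

lemma card_filter_mem_powersetCard_le (m : ℕ) (j : Fin n) :
    ((Finset.powersetCard (m + 1) (Finset.univ : Finset (Fin n))).filter fun v => j ∈ v).card
      ≤ (n - 1).choose m := by
  have hsub : ((Finset.powersetCard (m + 1) (Finset.univ : Finset (Fin n))).filter fun v => j ∈ v)
      ⊆ (Finset.powersetCard m (Finset.univ.erase j)).image (insert j) := by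
    intro v hv
    simp only [Finset.mem_filter, Finset.mem_powersetCard_univ] at hv
    refine Finset.mem_image.2 ⟨v.erase j, Finset.mem_powersetCard.2 ⟨?_, ?_⟩,
      Finset.insert_erase hv.2⟩
    · exact Finset.erase_subset_erase _ (Finset.subset_univ _)
    · rw [Finset.card_erase_of_mem hv.2, hv.1]; rfl
  refine (Finset.card_le_card hsub).trans (Finset.card_image_le.trans ?_)
  rw [Finset.card_powersetCard, Finset.card_erase_of_mem (Finset.mem_univ _), Finset.card_univ,
    Fintype.card_fin]

lemma choose_sub_div (p : ℕ) (hp : 1 ≤ p) (hpn : p ≤ n) :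
    (((n - 1).choose (n - p) : ℕ) : ℝ) = (n.choose p : ℝ) * p / n := by
  obtain ⟨p, rfl⟩ : ∃ q, p = q + 1 := ⟨p - 1, by omega⟩
  obtain ⟨n, rfl⟩ : ∃ q, n = q + 1 := ⟨n - 1, by omega⟩
  have h1 : n + 1 - (p + 1) = n - p := by omega
  rw [h1, Nat.add_sub_cancel, Nat.choose_symm (by omega), eq_div_iff (by positivity)]
  have := Nat.add_one_mul_choose_eq n p
  rw [mul_comm] at this
  exact_mod_cast this

lemma classifier_erase_of_notMem {k : ℕ} {z : Fin n → Obs d} {e : Finset (Fin n)} {q : Feature d}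
    {j : Fin n} (h : j ∉ nearest (fun i => (z i).1) e k q) :
    classifier k z (e.erase j) q = classifier k z e q :=
  classifier_congr_nearest (nearest_erase_of_notMem h)

-- If `j` is a neighbour of the i-th point in neither sample, it can be erased from both without
-- altering the votes, and the erased samples coincide. So the loss moves only in the three listed
-- cases.
open scoped Classical in
lemma abs_loss_sub_le {k : ℕ} {z z' : Fin n → Obs d} {j : Fin n}
    (h : ∀ l, l ≠ j → z l = z' l) (e : Finset (Fin n)) (i : Fin n) :
    |loss k z e i - loss k z' e i| ≤ (if i = j then (1 : ℝ) else 0)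
      + (if i ≠ j ∧ j ∈ nearest (fun l => (z l).1) e k (z i).1 then 1 else 0)
      + (if i ≠ j ∧ j ∈ nearest (fun l => (z' l).1) e k (z' i).1 then 1 else 0) := by
  by_cases hij : i = j
  · simpa [hij] using abs_loss_sub_le_one k
  by_cases h1 : j ∈ nearest (fun l => (z l).1) e k (z i).1
  · simp only [hij, if_false, ne_eq, not_false_eq_true, h1, and_self, if_true, true_and]
    have := abs_loss_sub_le_one k (z := z) (z' := z') (e := e) (e' := e) (i := i) (i' := i)
    split_ifs <;> linarith
  by_cases h2 : j ∈ nearest (fun l => (z' l).1) e k (z' i).1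
  · simp only [hij, if_false, ne_eq, not_false_eq_true, h2, and_self, if_true, true_and]
    have := abs_loss_sub_le_one k (z := z) (z' := z') (e := e) (e' := e) (i := i) (i' := i)
    split_ifs; linarith
  have hc : classifier k z e (z i).1 = classifier k z' e (z' i).1 := by
    rw [← classifier_erase_of_notMem h1, ← classifier_erase_of_notMem h2, ← h i hij]
    exact classifier_congr (fun l hl => h l (Finset.ne_of_mem_erase hl)) k _
  have : loss k z e i = loss k z' e i := by unfold loss; rw [hc, h i hij]
  simp [this, h1, h2, hij]

lemma abs_sum_loss_sub_le {k : ℕ} (hk : 1 ≤ k) {z z' : Fin n → Obs d}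
    (hz : TieFree fun i => (z i).1) (hz' : TieFree fun i => (z' i).1) {j : Fin n}
    (h : ∀ l, l ≠ j → z l = z' l) {v : Finset (Fin n)} (hj : j ∈ v) :
    |∑ i ∈ v, loss k z (v.erase i) i - ∑ i ∈ v, loss k z' (v.erase i) i|
      ≤ 1 + 2 * (k * stoneConst d) := by
  classical
  rw [← Finset.sum_sub_distrib]
  refine (Finset.abs_sum_le_sum_abs _ _).trans ?_
  refine (Finset.sum_le_sum fun i _ => abs_loss_sub_le h (v.erase i) i).trans ?_
  rw [Finset.sum_add_distrib, Finset.sum_add_distrib, Finset.sum_ite_eq', if_pos hj,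
    Finset.sum_boole, Finset.sum_boole]
  have h1 := card_stone_le hz hk v hj
  have h2 := card_stone_le hz' hk v hj
  linarith

/-- Changing one observation of a sample without ties changes the leave-`p`-out estimator by at
most `(1 + 2 k γ) / n`. -/
theorem abs_leavePOut_sub_le {p k : ℕ} (hp : 1 ≤ p) (hk : 1 ≤ k) (hpn : p ≤ n)
    {z z' : Fin n → Obs d} (hz : TieFree fun i => (z i).1) (hz' : TieFree fun i => (z' i).1)
    {j : Fin n} (h : ∀ l, l ≠ j → z l = z' l) :
    |leavePOut p k z - leavePOut p k z'| ≤ (1 + 2 * (k * stoneConst d)) / n := by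
  classical
  have hchoose : (0 : ℝ) < (n.choose p : ℝ) * p := by
    have := Nat.choose_pos hpn
    positivity
  have hγ := stoneConst_nonneg d
  rw [leavePOut_eq_sum_loss, leavePOut_eq_sum_loss, sum_sum_compl_eq_sum_sum_erase,
    sum_sum_compl_eq_sum_sum_erase, ← mul_sub, abs_mul, abs_of_pos (inv_pos.2 hchoose),
    ← Finset.sum_sub_distrib]
  have hbound : |∑ v ∈ Finset.powersetCard (n - p + 1) (Finset.univ : Finset (Fin n)),
      (∑ i ∈ v, loss k z (v.erase i) i - ∑ i ∈ v, loss k z' (v.erase i) i)|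
      ≤ ((n.choose p : ℝ) * p / n) * (1 + 2 * (k * stoneConst d)) := by
    refine (Finset.abs_sum_le_sum_abs _ _).trans ?_
    -- Only the sets containing `j` contribute; they number C(n-1, n-p) = C(n, p) p / n, which turns
    -- the normalisation into 1/n.
    calc _ ≤ ∑ v ∈ Finset.powersetCard (n - p + 1) (Finset.univ : Finset (Fin n)),
          (if j ∈ v then (1 : ℝ) else 0) * (1 + 2 * (k * stoneConst d)) := by
          refine Finset.sum_le_sum fun v _ => ?_
          by_cases hj : j ∈ v
          · simpa [hj] using abs_sum_loss_sub_le hk hz hz' h hj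
          · have : ∀ i ∈ v, loss k z (v.erase i) i = loss k z' (v.erase i) i := by
              intro i hi
              have hne : ∀ l ∈ v, z l = z' l := fun l hl => h l fun hlj => hj (hlj ▸ hl)
              unfold loss
              rw [hne i hi, classifier_congr (fun l hl => hne l (Finset.mem_of_mem_erase hl))]
            rw [Finset.sum_congr rfl this]
            simp [hj]
      _ ≤ _ := by
          rw [← Finset.sum_mul, Finset.sum_boole, ← choose_sub_div p hp hpn]
          refine mul_le_mul_of_nonneg_right ?_ (by positivity)
          exact_mod_cast card_filter_mem_powersetCard_le (n - p) j
  refine (mul_le_mul_of_nonneg_left hbound (inv_pos.2 hchoose).le).trans (le_of_eq ?_)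
  rw [div_mul_eq_mul_div, mul_div_assoc, inv_mul_cancel_left₀ hchoose.ne']

/-! ### Measurability of neighbours and votes. -/

section Measurability

variable {β : Type*} [MeasurableSpace β] {z : β → Fin n → Obs d} {q : β → Feature d}

lemma measurableSet_closer (hz : Measurable z) (hq : Measurable q) (j i : Fin n) :
    MeasurableSet {b | Closer (fun l => (z b l).1) (q b) j i} := by
  have h : ∀ l, Measurable fun b => dist (z b l).1 (q b) := fun l =>
    ((measurable_pi_apply l).comp hz).fst.dist hq
  unfold Closer
  exact (measurableSet_lt (h j) (h i)).union
    ((measurableSet_eq_fun (h j) (h i)).inter (MeasurableSet.const _))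

lemma measurableSet_mem_nearest (hz : Measurable z) (hq : Measurable q) (e : Finset (Fin n))
    (k : ℕ) (i : Fin n) :
    MeasurableSet {b | i ∈ nearest (fun l => (z b l).1) e k (q b)} := by
  classical
  have hm : Measurable fun b =>
      ∑ j ∈ e, if Closer (fun l => (z b l).1) (q b) j i then (1 : ℕ) else 0 :=
    Finset.measurable_sum _ fun j _ =>
      Measurable.ite (measurableSet_closer hz hq j i) measurable_const measurable_const
  have : {b | i ∈ nearest (fun l => (z b l).1) e k (q b)} = {b | i ∈ e} ∩
      {b | (∑ j ∈ e, if Closer (fun l => (z b l).1) (q b) j i then (1 : ℕ) else 0) < k} := by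
    ext b
    simp [nearest, Finset.sum_boole]
  rw [this]
  exact (MeasurableSet.const _).inter (measurableSet_lt hm measurable_const)

lemma measurable_classifier (hz : Measurable z) (hq : Measurable q) (k : ℕ)
    (e : Finset (Fin n)) : Measurable fun b => classifier k (z b) e (q b) := by
  classical
  have hsum : ∀ b, (∑ i ∈ nearest (fun i => (z b i).1) e k (q b),
      if (z b i).2 = true then (1 : ℝ) else 0) =
      ∑ i ∈ e, if i ∈ nearest (fun i => (z b i).1) e k (q b) then
        (if (z b i).2 = true then (1 : ℝ) else 0) else 0 := by
    intro b
    rw [← Finset.sum_filter (fun i => i ∈ nearest (fun i => (z b i).1) e k (q b)),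
      Finset.filter_mem_eq_inter, Finset.inter_eq_right.2 (nearest_subset _ _ _ _)]
  unfold classifier
  simp only [hsum]
  refine measurable_to_bool ?_
  have : (fun b => decide ((1 / 2 : ℝ) < (1 / (k : ℝ)) * ∑ i ∈ e,
      if i ∈ nearest (fun i => (z b i).1) e k (q b) then
        (if (z b i).2 = true then (1 : ℝ) else 0) else 0)) ⁻¹' {true} =
      {b | (1 / 2 : ℝ) < (1 / (k : ℝ)) * ∑ i ∈ e,
        if i ∈ nearest (fun i => (z b i).1) e k (q b) then
          (if (z b i).2 = true then (1 : ℝ) else 0) else 0} := by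
    ext b; simp
  rw [this]
  refine measurableSet_lt measurable_const (measurable_const.mul ?_)
  refine Finset.measurable_sum _ fun i _ =>
    Measurable.ite (measurableSet_mem_nearest hz hq e k i) ?_ measurable_const
  refine Measurable.ite ?_ measurable_const measurable_const
  exact ((measurable_pi_apply i).comp hz).snd (measurableSet_singleton true)

end Measurability

lemma measurable_loss (k : ℕ) (e : Finset (Fin n)) (i : Fin n) :
    Measurable fun z : Fin n → Obs d => loss k z e i := by
  unfold loss
  refine Measurable.ite ?_ measurable_const measurable_const
  have h1 : Measurable fun z : Fin n → Obs d => classifier k z e (z i).1 :=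
    measurable_classifier measurable_id (measurable_pi_apply i).fst k e
  exact (measurableSet_eq_fun h1 (measurable_pi_apply i).snd).compl

lemma measurable_leavePOut (p k : ℕ) :
    Measurable fun z : Fin n → Obs d => leavePOut p k z := by
  simp only [leavePOut_eq_sum_loss]
  exact measurable_const.mul (Finset.measurable_sum _ fun e _ =>
    Finset.measurable_sum _ fun i _ => measurable_loss k e i)

/-! ### Almost sure absence of ties and exchangeability. -/

/-- The law of a sample of size `n` from `ν`. -/
noncomputable abbrev sampleLaw (ν : Measure (Obs d)) (n : ℕ) : Measure (Fin n → Obs d) :=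
  Measure.pi fun _ : Fin n => ν

variable {ν : Measure (Obs d)} [IsProbabilityMeasure ν]

lemma integrable_loss (k : ℕ) (e : Finset (Fin n)) (i : Fin n) :
    Integrable (fun z : Fin n → Obs d => loss k z e i) (sampleLaw ν n) :=
  integrable_of_abs_le (C := 1) (measurable_loss k e i) fun z => by
    rw [abs_of_nonneg (loss_nonneg _ _ _ _)]; exact loss_le_one _ _ _ _

lemma ae_tieFree (hties : NoDistanceTies (ν.map Prod.fst)) (n : ℕ) :
    ∀ᵐ z ∂(sampleLaw ν n), TieFree fun i => (z i).1 := by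
  have hX : iIndepFun (fun (i : Fin n) (z : Fin n → Obs d) => (z i).1) (sampleLaw ν n) :=
    iIndepFun_pi (X := fun _ => Prod.fst) fun _ => measurable_fst.aemeasurable
  have hm : ∀ i : Fin n, Measurable fun z : Fin n → Obs d => (z i).1 :=
    fun i => (measurable_pi_apply i).fst
  have hmap : ∀ i : Fin n, (sampleLaw ν n).map (fun z => (z i).1) = ν.map Prod.fst := by
    intro i
    have h := (measurePreserving_eval (fun _ : Fin n => ν) i).map_eq
    conv_rhs => rw [← h, Measure.map_map measurable_fst (measurable_pi_apply i)]
    rfl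
  simp only [TieFree, MeasureTheory.ae_all_iff]
  intro i j l hij hil hjl
  have h1 : (sampleLaw ν n).map (fun z => ((z j).1, (z l).1))
      = (ν.map Prod.fst).prod (ν.map Prod.fst) := by
    rw [(indepFun_iff_map_prod_eq_prod_map_map (hm j).aemeasurable (hm l).aemeasurable).1
      (hX.indepFun hjl), hmap, hmap]
  have h2 : (sampleLaw ν n).map (fun z => ((z i).1, ((z j).1, (z l).1)))
      = (ν.map Prod.fst).prod ((ν.map Prod.fst).prod (ν.map Prod.fst)) := by
    rw [(indepFun_iff_map_prod_eq_prod_map_map (hm i).aemeasurable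
      ((hm j).prodMk (hm l)).aemeasurable).1
      (hX.indepFun_prodMk hm j l i hij.symm hil.symm).symm, hmap, h1]
  unfold NoDistanceTies at hties
  rw [← h2] at hties
  exact ae_of_ae_map ((hm i).prodMk ((hm j).prodMk (hm l))).aemeasurable hties

lemma measurePreserving_comp_embedding (φ : Fin m ↪ Fin n) :
    MeasurePreserving (fun (z : Fin n → Obs d) l => z (φ l)) (sampleLaw ν n)
      (sampleLaw ν m) := by
  have hX : iIndepFun (fun (i : Fin n) (z : Fin n → Obs d) => z i) (sampleLaw ν n) :=
    iIndepFun_pi (X := fun _ => id) fun _ => measurable_id.aemeasurable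
  refine ⟨by fun_prop, ?_⟩
  have h := hX.precomp φ.injective
  rw [iIndepFun_iff_map_fun_eq_pi_map (fun i => (measurable_pi_apply _).aemeasurable)] at h
  refine h.trans ?_
  congr 1
  funext i
  exact (measurePreserving_eval (fun _ : Fin n => ν) (φ i)).map_eq

lemma closer_comp_iff_of_tieFree {φ : Fin m ↪ Fin n} {x : Fin n → Feature d} (hx : TieFree x)
    {e : Finset (Fin m)} {q : Fin m} (hq : q ∉ e) :
    ∀ i ∈ e, ∀ j ∈ e, Closer (fun l => x (φ l)) (x (φ q)) j i ↔ Closer x (x (φ q)) (φ j) (φ i) :=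
  fun _ hi _ hj => closer_comp_iff_of_ne fun hji => hx _ _ _
    (φ.injective.ne fun h => hq (h ▸ hj)) (φ.injective.ne fun h => hq (h ▸ hi))
    (φ.injective.ne hji)

/-- The expected loss does not change when the indices are renamed. -/
lemma integral_loss_map (hties : NoDistanceTies (ν.map Prod.fst)) (k : ℕ) (φ : Fin m ↪ Fin n)
    {e : Finset (Fin m)} {q : Fin m} (hq : q ∉ e) :
    ∫ z, loss k z (e.map φ) (φ q) ∂(sampleLaw ν n) = ∫ z, loss k z e q ∂(sampleLaw ν m) := by
  have hφ := measurePreserving_comp_embedding (ν := ν) φ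
  rw [← hφ.map_eq, integral_map hφ.measurable.aemeasurable
    (measurable_loss k e q).aestronglyMeasurable]
  refine integral_congr_ae ?_
  filter_upwards [ae_tieFree hties n] with z hz
  unfold loss
  rw [classifier_map (z := z) (closer_comp_iff_of_tieFree hz hq)]

lemma measureReal_mem_nearest_map (hties : NoDistanceTies (ν.map Prod.fst)) (k : ℕ)
    (φ : Fin m ↪ Fin n) {e : Finset (Fin m)} {q : Fin m} (hq : q ∉ e) (i : Fin m) :
    (sampleLaw ν n).real {z | φ i ∈ nearest (fun l => (z l).1) (e.map φ) k (z (φ q)).1}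
      = (sampleLaw ν m).real {z | i ∈ nearest (fun l => (z l).1) e k (z q).1} := by
  have hφ := measurePreserving_comp_embedding (ν := ν) φ
  have hms : MeasurableSet {z : Fin m → Obs d | i ∈ nearest (fun l => (z l).1) e k (z q).1} :=
    measurableSet_mem_nearest measurable_id (measurable_pi_apply q).fst e k i
  rw [← hφ.measureReal_preimage hms.nullMeasurableSet]
  refine measureReal_congr ?_
  filter_upwards [ae_tieFree hties n] with z hz
  have h := nearest_map (x := fun l => (z l).1) (closer_comp_iff_of_tieFree (φ := φ) hz hq) k
  refine propext ?_
  change φ i ∈ nearest (fun l => (z l).1) (e.map φ) k (z (φ q)).1 ↔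
    i ∈ nearest (fun l => (z (φ l)).1) e k (z (φ q)).1
  rw [h, Finset.mem_map' φ]

/-- Extend a bijection from `e` to `e'` to a permutation, then swap the image of `q` with `q'`. Both
lie outside `e'`, so the swap leaves `e'` alone. -/
lemma exists_embedding_map_eq {e e' : Finset (Fin n)} {q q' : Fin n} (hq : q ∉ e) (hq' : q' ∉ e')
    (hcard : e.card = e'.card) : ∃ φ : Fin n ↪ Fin n, e.map φ = e' ∧ φ q = q' := by
  classical
  let σ : Equiv.Perm (Fin n) := (Finset.equivOfCardEq hcard).extendSubtype
  have hmem : ∀ x ∈ e, σ x ∈ e' := fun x hx => Equiv.extendSubtype_mem _ x hx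
  have hσq : σ q ∉ e' := Equiv.extendSubtype_not_mem _ q hq
  refine ⟨(σ.trans (Equiv.swap (σ q) q')).toEmbedding, ?_, by simp⟩
  refine Finset.eq_of_subset_of_card_le ?_ (by simp [hcard])
  intro a ha
  obtain ⟨b, hb, rfl⟩ := Finset.mem_map.1 ha
  have hb' := hmem b hb
  rw [Equiv.coe_toEmbedding, Equiv.trans_apply, Equiv.swap_apply_of_ne_of_ne
    (ne_of_mem_of_not_mem hb' hσq) (ne_of_mem_of_not_mem hb' hq')]
  exact hb'

/-- The expected loss depends on the size of the subsample only. -/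
lemma integral_loss_eq (hties : NoDistanceTies (ν.map Prod.fst)) (k : ℕ)
    {e e' : Finset (Fin n)} {q q' : Fin n} (hq : q ∉ e) (hq' : q' ∉ e')
    (hcard : e.card = e'.card) :
    ∫ z, loss k z e q ∂(sampleLaw ν n) = ∫ z, loss k z e' q' ∂(sampleLaw ν n) := by
  obtain ⟨φ, rfl, rfl⟩ := exists_embedding_map_eq hq hq' hcard
  exact (integral_loss_map hties k φ hq).symm

/-- By exchangeability all points of `e` are equally likely to be neighbours, and the expected
number of neighbours is at most k. -/
lemma measureReal_mem_nearest_le (hties : NoDistanceTies (ν.map Prod.fst)) (k : ℕ)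
    {e : Finset (Fin n)} {q i : Fin n} (hq : q ∉ e) (hi : i ∈ e) :
    (sampleLaw ν n).real {z | i ∈ nearest (fun l => (z l).1) e k (z q).1} ≤ k / e.card := by
  classical
  have hcard : (0 : ℝ) < e.card := by exact_mod_cast Finset.card_pos.2 ⟨i, hi⟩
  rw [le_div_iff₀' hcard]
  have heq : ∀ j ∈ e, (sampleLaw ν n).real {z | j ∈ nearest (fun l => (z l).1) e k (z q).1}
      = (sampleLaw ν n).real {z | i ∈ nearest (fun l => (z l).1) e k (z q).1} := by
    intro j hj
    have hmap : e.map (Equiv.swap i j).toEmbedding = e := by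
      refine Finset.eq_of_subset_of_card_le ?_ (by simp)
      intro a ha
      obtain ⟨b, hb, rfl⟩ := Finset.mem_map.1 ha
      rw [Equiv.coe_toEmbedding, Equiv.swap_apply_def]
      split_ifs <;> assumption
    have hqs : Equiv.swap i j q = q :=
      Equiv.swap_apply_of_ne_of_ne (fun h => hq (h ▸ hi)) (fun h => hq (h ▸ hj))
    have := measureReal_mem_nearest_map (ν := ν) hties k (Equiv.swap i j).toEmbedding hq i
    simpa only [hmap, Equiv.coe_toEmbedding, hqs, Equiv.swap_apply_left] using this
  have hms : ∀ j : Fin n, MeasurableSet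
      {z : Fin n → Obs d | j ∈ nearest (fun l => (z l).1) e k (z q).1} := fun j =>
    measurableSet_mem_nearest measurable_id (measurable_pi_apply q).fst e k j
  calc (e.card : ℝ) * (sampleLaw ν n).real {z | i ∈ nearest (fun l => (z l).1) e k (z q).1}
      = ∑ j ∈ e, (sampleLaw ν n).real {z | j ∈ nearest (fun l => (z l).1) e k (z q).1} := by
        rw [Finset.sum_congr rfl heq]; simp
    _ = ∫ z, ∑ j ∈ e, ({z : Fin n → Obs d | j ∈ nearest (fun l => (z l).1) e k (z q).1}.indicator
          (fun _ => (1 : ℝ))) z ∂(sampleLaw ν n) := by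
        rw [integral_finsetSum _ fun j _ => (integrable_const _).indicator (hms j)]
        refine Finset.sum_congr rfl fun j _ => ?_
        rw [integral_indicator_const _ (hms j)]; simp
    _ ≤ ∫ z, (k : ℝ) ∂(sampleLaw ν n) := by
        refine integral_mono (integrable_finsetSum _ fun j _ =>
          (integrable_const _).indicator (hms j)) (integrable_const _) fun z => ?_
        simp only [Set.indicator_apply, Set.mem_ofPred_eq]
        rw [Finset.sum_boole, Finset.filter_mem_eq_inter,
          Finset.inter_eq_right.2 (nearest_subset _ _ _ _), card_nearest]
        exact_mod_cast min_le_left _ _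
    _ = k := by simp

/-! ### Bounds on the largest binomial atom. -/

section Binomial

/-- The factor 3l + 1 makes the induction close: the ratio of consecutive central binomials reduces
the step to a polynomial inequality whose two sides differ, up to a constant, only by 19l ≤ 20l. -/
lemma centralBinom_sq_mul_le (l : ℕ) : (l.centralBinom : ℝ) ^ 2 * (3 * l + 1) ≤ (4 ^ l) ^ 2 := by
  induction l with
  | zero => simp
  | succ l ih =>
    have h : ((l : ℝ) + 1) * (l + 1).centralBinom = 2 * (2 * l + 1) * l.centralBinom := by
      exact_mod_cast Nat.succ_mul_centralBinom_succ l
    have hl : (0 : ℝ) ≤ l := Nat.cast_nonneg l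
    have hpos : (0 : ℝ) < ((l : ℝ) + 1) ^ 2 := by positivity
    refine le_of_mul_le_mul_left ?_ hpos
    have hpoly : (2 * (2 * (l : ℝ) + 1)) ^ 2 * (3 * l + 4) ≤ 16 * ((l : ℝ) + 1) ^ 2 * (3 * l + 1) := by
      nlinarith
    push_cast
    calc ((l : ℝ) + 1) ^ 2 * (((l + 1).centralBinom : ℝ) ^ 2 * (3 * (l + 1) + 1))
        = (((l : ℝ) + 1) * (l + 1).centralBinom) ^ 2 * (3 * l + 4) := by ring
      _ = ((2 * (2 * (l : ℝ) + 1)) ^ 2 * (3 * l + 4)) * (l.centralBinom : ℝ) ^ 2 := by rw [h]; ring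
      _ ≤ (16 * ((l : ℝ) + 1) ^ 2 * (3 * l + 1)) * (l.centralBinom : ℝ) ^ 2 :=
          mul_le_mul_of_nonneg_right hpoly (sq_nonneg _)
      _ = 16 * ((l : ℝ) + 1) ^ 2 * ((l.centralBinom : ℝ) ^ 2 * (3 * l + 1)) := by ring
      _ ≤ 16 * ((l : ℝ) + 1) ^ 2 * (4 ^ l) ^ 2 := mul_le_mul_of_nonneg_left ih (by positivity)
      _ = _ := by rw [pow_succ]; ring

/-- An upper bound for the probability that `k - 1` independent labels with the same law contain
exactly `k / 2` ones. -/
noncomputable def tieProb (k : ℕ) : ℝ :=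
  (((k - 1) / 2).centralBinom : ℝ) / 4 ^ ((k - 1) / 2)

lemma tieProb_nonneg (k : ℕ) : 0 ≤ tieProb k := by unfold tieProb; positivity

/-- The argument needs k ≤ 3l + 1 with l = ⌊(k - 1)/2⌋; since k ≤ 2l + 2, this can fail only for l =
0 and k = 2. -/
lemma mul_tieProb_sq_le {k : ℕ} (hk : 1 ≤ k) (hk2 : k ≠ 2) : (k : ℝ) * tieProb k ^ 2 ≤ 1 := by
  set l := (k - 1) / 2 with hl
  have hkl : (k : ℝ) ≤ 3 * l + 1 := by
    have : k ≤ 3 * l + 1 := by omega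
    exact_mod_cast this
  have h := centralBinom_sq_mul_le l
  have h4 : (0 : ℝ) < (4 ^ l) ^ 2 := by positivity
  unfold tieProb
  rw [← hl, div_pow, mul_div_assoc', div_le_one h4, mul_comm]
  exact (mul_le_mul_of_nonneg_left hkl (sq_nonneg _)).trans h

/-- This handles the asymmetric atom that occurs for even k. With v = (2q - 1)² one has 4q(1 - q) =
1 - v, Bernoulli gives (1 - v)^t (1 + tv) ≤ (1 - v²)^t ≤ 1, and what remains is a quadratic
inequality in q, settled by completing the square. -/
lemma two_mul_add_one_mul_pow_le (t : ℕ) {q : ℝ} (h0 : 0 ≤ q) (h1 : q ≤ 1) :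
    (2 * t + 1) * q * (4 * (q * (1 - q))) ^ t ≤ t + 1 := by
  have ht : (0 : ℝ) ≤ t := Nat.cast_nonneg t
  set v := (2 * q - 1) ^ 2 with hv
  have hv0 : 0 ≤ v := sq_nonneg _
  have hv1 : v ≤ 1 := by rw [hv]; nlinarith
  have hq : 4 * (q * (1 - q)) = 1 - v := by rw [hv]; ring
  have hbern : (1 - v) ^ t * (1 + t * v) ≤ 1 := by
    calc (1 - v) ^ t * (1 + t * v) ≤ (1 - v) ^ t * (1 + v) ^ t :=
          mul_le_mul_of_nonneg_left (one_add_mul_le_pow (by linarith) t)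
            (pow_nonneg (by linarith) _)
      _ = (1 - v ^ 2) ^ t := by rw [← mul_pow]; ring_nf
      _ ≤ 1 := pow_le_one₀ (by nlinarith) (by nlinarith)
  have hquad : (2 * t + 1) * q ≤ (t + 1) * (1 + t * v) := by
    rcases Nat.eq_zero_or_pos t with h | h
    · subst h; simp; linarith
    · have h1t : (1 : ℝ) ≤ t := by exact_mod_cast h
      have hpos : (0 : ℝ) < 8 * t * (t + 1) := by positivity
      refine le_of_mul_le_mul_left ?_ hpos
      rw [hv]
      nlinarith [sq_nonneg (4 * t * (t + 1) * (2 * q - 1) - (2 * t + 1))]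
  rw [hq]
  calc (2 * t + 1) * q * (1 - v) ^ t ≤ (t + 1) * (1 + t * v) * (1 - v) ^ t :=
        mul_le_mul_of_nonneg_right hquad (pow_nonneg (by linarith) _)
    _ = (t + 1) * ((1 - v) ^ t * (1 + t * v)) := by ring
    _ ≤ (t + 1) * 1 := mul_le_mul_of_nonneg_left hbern (by linarith)
    _ = t + 1 := mul_one _

/-- The homogeneous form, with a + b in place of 1, avoids normalising by the mass of a ball that
may be null. For odd k it is 4ab ≤ (a + b)²; for even k it is the previous lemma at q = a/(a + b).
-/
lemma choose_mul_pow_mul_pow_le {k : ℕ} (hk : 1 ≤ k) {a b : ℝ} (ha : 0 ≤ a) (hb : 0 ≤ b) :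
    ((k - 1).choose (k / 2) : ℝ) * a ^ (k / 2) * b ^ (k - 1 - k / 2)
      ≤ tieProb k * (a + b) ^ (k - 1) := by
  set t := (k - 1) / 2 with ht
  have h4 : (0 : ℝ) < 4 ^ t := by positivity
  unfold tieProb
  rw [← ht]
  rcases Nat.even_or_odd k with he | ho
  · have h1 : k - 1 = 2 * t + 1 := by obtain ⟨r, hr⟩ := he; omega
    have h2 : k / 2 = t + 1 := by omega
    have h3 : 2 * t + 1 - (t + 1) = t := by omega
    rw [h1, h2, h3]
    have hch : ((2 * t + 1).choose (t + 1) : ℝ) * (t + 1) = (2 * t + 1) * t.centralBinom := by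
      have := Nat.add_one_mul_choose_eq (2 * t) t
      rw [Nat.centralBinom_eq_two_mul_choose]
      exact_mod_cast this.symm
    rcases (add_nonneg ha hb).eq_or_lt with h0 | hS
    · have ha0 : a = 0 := by linarith
      simp [ha0]
      positivity
    · have hmain := two_mul_add_one_mul_pow_le t (q := a / (a + b)) (by positivity)
        ((div_le_one hS).2 (by linarith))
      have hq : 1 - a / (a + b) = b / (a + b) := by field_simp; ring
      rw [hq] at hmain
      have hmain' : (2 * t + 1) * a ^ (t + 1) * b ^ t * 4 ^ t
          ≤ (t + 1) * (a + b) ^ (2 * t + 1) := by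
        have hmul := mul_le_mul_of_nonneg_right hmain
          (pow_nonneg hS.le (2 * t + 1))
        refine le_trans (le_of_eq ?_) hmul
        have e1 : (4 * (a / (a + b) * (b / (a + b)))) ^ t * (a + b) ^ (2 * t)
            = 4 ^ t * (a ^ t * b ^ t) := by
          rw [pow_mul, ← mul_pow, ← mul_pow, ← mul_pow]
          congr 1; field_simp
        calc (2 * t + 1) * a ^ (t + 1) * b ^ t * 4 ^ t
            = (2 * t + 1) * (a / (a + b)) * (a + b) * (4 ^ t * (a ^ t * b ^ t)) := by
              rw [mul_assoc (2 * (t : ℝ) + 1) (a / (a + b)), div_mul_cancel₀ _ hS.ne']; ring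
          _ = _ := by rw [← e1]; ring
      have htp : (0 : ℝ) < t + 1 := by positivity
      rw [div_mul_eq_mul_div, le_div_iff₀ h4]
      refine le_of_mul_le_mul_left ?_ htp
      calc ((t : ℝ) + 1) * (((2 * t + 1).choose (t + 1) : ℝ) * a ^ (t + 1) * b ^ t * 4 ^ t)
          = (((2 * t + 1).choose (t + 1) : ℝ) * (t + 1)) * (a ^ (t + 1) * b ^ t * 4 ^ t) := by ring
        _ = t.centralBinom * ((2 * t + 1) * a ^ (t + 1) * b ^ t * 4 ^ t) := by rw [hch]; ring
        _ ≤ t.centralBinom * ((t + 1) * (a + b) ^ (2 * t + 1)) :=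
            mul_le_mul_of_nonneg_left hmain' (Nat.cast_nonneg _)
        _ = _ := by ring
  · have h1 : k - 1 = 2 * t := by obtain ⟨r, hr⟩ := ho; omega
    have h2 : k / 2 = t := by obtain ⟨r, hr⟩ := ho; omega
    have h3 : 2 * t - t = t := by omega
    rw [h1, h2, h3, ← Nat.centralBinom_eq_two_mul_choose, div_mul_eq_mul_div, le_div_iff₀ h4,
      mul_assoc, mul_assoc]
    refine mul_le_mul_of_nonneg_left ?_ (Nat.cast_nonneg _)
    rw [pow_mul, ← mul_pow, ← mul_pow]
    exact pow_le_pow_left₀ (by positivity) (by nlinarith [sq_nonneg (a - b)]) t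

end Binomial

/-! ### Labels of points conditioned to lie in a ball. -/

section Conditioning

/-- Split the event according to the set `U` of coordinates labelled 1. Each piece is a product set,
so the pieces add up to a binomial term in the masses of the two label classes of `B`. -/
lemma pi_card_eq_le {ι : Type*} [Fintype ι] [DecidableEq ι] {B : Set (Obs d)} {k : ℕ} (hk : 1 ≤ k) (hcard : Fintype.card ι = k - 1) :
    (Measure.pi fun _ : ι => ν).real
        {t | (∀ l, t l ∈ B) ∧ (Finset.univ.filter fun l => (t l).2 = true).card = k / 2}
      ≤ tieProb k * (Measure.pi fun _ : ι => ν).real {t | ∀ l, t l ∈ B} := by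
  set B₁ : Set (Obs d) := B ∩ Prod.snd ⁻¹' {true} with hB₁
  set B₀ : Set (Obs d) := B \ Prod.snd ⁻¹' {true} with hB₀
  have hm : MeasurableSet ((Prod.snd : Obs d → Bool) ⁻¹' {true}) :=
    measurable_snd (measurableSet_singleton true)
  have hadd : ν.real B₁ + ν.real B₀ = ν.real B := measureReal_inter_add_sdiff hm
  have hrect : ∀ A : ι → Set (Obs d), (Measure.pi fun _ : ι => ν).real {t | ∀ l, t l ∈ A l}
      = ∏ l, ν.real (A l) := by
    intro A
    have : {t : ι → Obs d | ∀ l, t l ∈ A l} = Set.univ.pi A := by ext; simp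
    rw [this, measureReal_def, Measure.pi_pi, ENNReal.toReal_prod]
    rfl
  have hsub : {t : ι → Obs d | (∀ l, t l ∈ B) ∧
      (Finset.univ.filter fun l => (t l).2 = true).card = k / 2} ⊆
      ⋃ U ∈ Finset.powersetCard (k / 2) (Finset.univ : Finset ι),
        {t | ∀ l, t l ∈ if l ∈ U then B₁ else B₀} := by
    rintro t ⟨hB', hc⟩
    refine Set.mem_biUnion (x := Finset.univ.filter fun l => (t l).2 = true)
      (by simpa using hc) fun l => ?_
    by_cases hl : (t l).2 = true
    · simp [hl, hB₁, hB' l]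
    · simp [hl, hB₀, hB' l]
  rw [hrect, Finset.prod_const, Finset.card_univ, hcard, ← hadd]
  refine (measureReal_mono hsub (measure_ne_top _ _)).trans
    ((measureReal_biUnion_finset_le _ _).trans ?_)
  refine le_trans (le_of_eq ?_) (choose_mul_pow_mul_pow_le hk measureReal_nonneg measureReal_nonneg)
  have hterm : ∀ U ∈ Finset.powersetCard (k / 2) (Finset.univ : Finset ι),
      (Measure.pi fun _ : ι => ν).real {t | ∀ l, t l ∈ if l ∈ U then B₁ else B₀}
        = ν.real B₁ ^ (k / 2) * ν.real B₀ ^ (k - 1 - k / 2) := by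
    intro U hU
    have hU' := (Finset.mem_powersetCard_univ).1 hU
    rw [hrect]
    simp only [apply_ite (fun A => ν.real A)]
    rw [Finset.prod_ite, Finset.prod_const, Finset.prod_const, Finset.filter_univ_mem, hU',
      Finset.filter_not, Finset.filter_univ_mem, Finset.card_sdiff_of_subset (Finset.subset_univ _),
      Finset.card_univ, hcard, hU']
  rw [Finset.sum_congr rfl hterm, Finset.sum_const, Finset.card_powersetCard, Finset.card_univ,
    hcard, nsmul_eq_mul, mul_assoc]

open scoped Classical in
/-- Sections of events along a set `T` of coordinates may be compared to compare the events. -/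
lemma pi_real_le_of_sections {T : Finset (Fin n)} {F G : Set (Fin n → Obs d)}
    (hF : MeasurableSet F) (hG : MeasurableSet G) {β : ℝ} (hβ : 0 ≤ β)
    (h : ∀ w : {i // i ∉ T} → Obs d,
      (Measure.pi fun _ : {i // i ∈ T} => ν).real
          {t | (fun i => if hi : i ∈ T then t ⟨i, hi⟩ else w ⟨i, hi⟩) ∈ F}
        ≤ β * (Measure.pi fun _ : {i // i ∈ T} => ν).real
          {t | (fun i => if hi : i ∈ T then t ⟨i, hi⟩ else w ⟨i, hi⟩) ∈ G}) :
    (sampleLaw ν n).real F ≤ β * (sampleLaw ν n).real G := by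
  have he := (measurePreserving_piEquivPiSubtypeProd (fun _ : Fin n => ν) (· ∈ T)).symm
  set E := (MeasurableEquiv.piEquivPiSubtypeProd (fun _ : Fin n => Obs d) (· ∈ T)).symm with hE
  have hEapp : ∀ t w, E (t, w) = fun i => if hi : i ∈ T then t ⟨i, hi⟩ else w ⟨i, hi⟩ := by
    intro t w; rfl
  have hsec : ∀ A : Set (Fin n → Obs d), MeasurableSet A → sampleLaw ν n A =
      ∫⁻ w, (Measure.pi fun _ : {i // i ∈ T} => ν) {t | E (t, w) ∈ A}
        ∂(Measure.pi fun _ : {i // i ∉ T} => ν) := by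
    intro A hA
    rw [← he.measure_preimage hA.nullMeasurableSet, Measure.prod_apply_symm (he.measurable hA)]
    refine lintegral_congr fun w => ?_
    congr!
  have hsecm : ∀ A : Set (Fin n → Obs d), MeasurableSet A → Measurable fun w =>
      (Measure.pi fun _ : {i // i ∈ T} => ν) {t | E (t, w) ∈ A} := by
    intro A hA
    exact measurable_measure_prodMk_right (he.measurable hA)
  have hle : sampleLaw ν n F ≤ ENNReal.ofReal β * sampleLaw ν n G := by
    rw [hsec F hF, hsec G hG, ← lintegral_const_mul _ (hsecm G hG)]
    refine lintegral_mono fun w => ?_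
    have := ENNReal.ofReal_le_ofReal (h w)
    rw [ENNReal.ofReal_mul hβ, ofReal_measureReal, ofReal_measureReal] at this
    exact this
  have := ENNReal.toReal_mono (ENNReal.mul_ne_top ENNReal.ofReal_ne_top (measure_ne_top _ _)) hle
  rwa [ENNReal.toReal_mul, ENNReal.toReal_ofReal hβ] at this

/-- Given the observations outside `T`, the labels of points of `T` that are known to lie in a ball
are independent with the same law, so that they are seldom balanced. -/
lemma measureReal_balanced_inter_le {T : Finset (Fin n)} {k : ℕ} (hk : 1 ≤ k)
    (hT : T.card = k - 1) {q j : Fin n} (hq : q ∉ T) (hj : j ∉ T) {R : Set (Fin n → Obs d)}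
    (hR : MeasurableSet R)
    (hRT : ∀ z z' : Fin n → Obs d, (∀ l, l ∉ T → z l = z' l) → z ∈ R → z' ∈ R) :
    (sampleLaw ν n).real ({z | (∀ l ∈ T, dist (z l).1 (z q).1 < dist (z j).1 (z q).1) ∧
        (T.filter fun l => (z l).2 = true).card = k / 2} ∩ R)
      ≤ tieProb k * (sampleLaw ν n).real
        ({z | ∀ l ∈ T, dist (z l).1 (z q).1 < dist (z j).1 (z q).1} ∩ R) := by
  classical
  have hdist : ∀ l : Fin n, Measurable fun z : Fin n → Obs d => dist (z l).1 (z q).1 := fun l =>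
    (measurable_pi_apply l).fst.dist (measurable_pi_apply q).fst
  have hm1 : MeasurableSet
      {z : Fin n → Obs d | ∀ l ∈ T, dist (z l).1 (z q).1 < dist (z j).1 (z q).1} := by
    have : {z : Fin n → Obs d | ∀ l ∈ T, dist (z l).1 (z q).1 < dist (z j).1 (z q).1}
        = ⋂ l ∈ T, {z | dist (z l).1 (z q).1 < dist (z j).1 (z q).1} := by ext; simp
    rw [this]
    exact Finset.measurableSet_biInter _ fun l _ => measurableSet_lt (hdist l) (hdist j)
  have hm2 : MeasurableSet
      {z : Fin n → Obs d | (T.filter fun l => (z l).2 = true).card = k / 2} := by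
    have hc : Measurable fun z : Fin n → Obs d => ∑ l ∈ T, if (z l).2 = true then (1 : ℕ) else 0 :=
      Finset.measurable_sum _ fun l _ => Measurable.ite
        ((measurable_pi_apply l).snd (measurableSet_singleton true)) measurable_const
        measurable_const
    have : {z : Fin n → Obs d | (T.filter fun l => (z l).2 = true).card = k / 2}
        = {z | (∑ l ∈ T, if (z l).2 = true then (1 : ℕ) else 0) = k / 2} := by
      ext z; simp [Finset.sum_boole]
    rw [this]
    exact measurableSet_eq_fun hc measurable_const
  have hm12 : MeasurableSet {z : Fin n → Obs d |
      (∀ l ∈ T, dist (z l).1 (z q).1 < dist (z j).1 (z q).1) ∧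
      (T.filter fun l => (z l).2 = true).card = k / 2} := hm1.inter hm2
  refine pi_real_le_of_sections (T := T) (hm12.inter hR) (hm1.inter hR)
    (tieProb_nonneg k) fun w => ?_
  set glue : ({i // i ∈ T} → Obs d) → Fin n → Obs d :=
    fun t i => if hi : i ∈ T then t ⟨i, hi⟩ else w ⟨i, hi⟩ with hglue
  -- Its centre and radius involve only the `q`-th and `j`-th points, both frozen outside `T`.
  set B : Set (Obs d) := {o | dist o.1 (w ⟨q, hq⟩).1 < dist (w ⟨j, hj⟩).1 (w ⟨q, hq⟩).1} with hB
  have hgT : ∀ t (l : {i // i ∈ T}), glue t l = t l := fun t l => by simp [hglue]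
  have hgn : ∀ t l (hl : l ∉ T), glue t l = w ⟨l, hl⟩ := fun t l hl => by simp [hglue, hl]
  have hball : ∀ t, (∀ l ∈ T, dist (glue t l).1 (glue t q).1 < dist (glue t j).1 (glue t q).1) ↔
      ∀ l, t l ∈ B := by
    intro t
    rw [hgn t q hq, hgn t j hj]
    constructor
    · intro h l
      have := h l l.2
      rwa [hgT] at this
    · intro h l hl
      have := h ⟨l, hl⟩
      rw [← hgT t ⟨l, hl⟩] at this
      exact this
  have hcount : ∀ t, (T.filter fun l => (glue t l).2 = true).card
      = (Finset.univ.filter fun l : {i // i ∈ T} => (t l).2 = true).card := by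
    intro t
    rw [← Finset.card_map (Function.Embedding.subtype (· ∈ T))]
    congr 1
    ext l
    simp only [Finset.mem_filter, Finset.mem_map, Finset.mem_univ, true_and,
      Function.Embedding.subtype_apply, Subtype.exists, exists_and_right, exists_eq_right]
    constructor
    · rintro ⟨hl, h⟩
      exact ⟨hl, by rw [← hgT t ⟨l, hl⟩]; exact h⟩
    · rintro ⟨hl, h⟩
      exact ⟨hl, by rw [← hgT t ⟨l, hl⟩] at h; exact h⟩
  change (Measure.pi _).real {t | glue t ∈ _} ≤
    tieProb k * (Measure.pi _).real {t | glue t ∈ _}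
  -- `R` ignores the coordinates in `T`, so its section is everything or empty.
  by_cases hw : ∃ t, glue t ∈ R
  · obtain ⟨t₀, ht₀⟩ := hw
    have hall : ∀ t, glue t ∈ R := fun t => hRT _ _ (fun l hl => by
      rw [hgn t₀ l hl, hgn t l hl]) ht₀
    have key := pi_card_eq_le (ν := ν) (ι := {i // i ∈ T}) (B := B) hk (by simpa using hT)
    have e1 : {t | glue t ∈ {z : Fin n → Obs d |
        (∀ l ∈ T, dist (z l).1 (z q).1 < dist (z j).1 (z q).1) ∧
        (T.filter fun l => (z l).2 = true).card = k / 2} ∩ R}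
        = {t | (∀ l, t l ∈ B) ∧ (Finset.univ.filter fun l => (t l).2 = true).card = k / 2} := by
      ext t
      simp only [Set.mem_inter_iff, Set.mem_ofPred_eq, hall t, and_true, hball t, hcount t]
    have e2 : {t | glue t ∈ {z : Fin n → Obs d |
        ∀ l ∈ T, dist (z l).1 (z q).1 < dist (z j).1 (z q).1} ∩ R} = {t | ∀ l, t l ∈ B} := by
      ext t
      simp only [Set.mem_inter_iff, Set.mem_ofPred_eq, hall t, and_true, hball t]
    rw [e1, e2]
    convert key
  · have e1 : {t | glue t ∈ {z : Fin n → Obs d |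
        (∀ l ∈ T, dist (z l).1 (z q).1 < dist (z j).1 (z q).1) ∧
        (T.filter fun l => (z l).2 = true).card = k / 2} ∩ R} = ∅ := by
      ext t
      simp only [Set.mem_ofPred_eq, Set.mem_empty_iff_false, iff_false]
      exact fun h => hw ⟨t, h.2⟩
    rw [e1, measureReal_empty]
    exact mul_nonneg (tieProb_nonneg k) measureReal_nonneg

end Conditioning

/-! ### Votes flipped by deleting one observation. -/

lemma classifier_eq_decide_lt {k : ℕ} (hk : 1 ≤ k) (z : Fin n → Obs d) (e : Finset (Fin n))
    (q : Feature d) : classifier k z e q = decide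
      (k < 2 * ((nearest (fun i => (z i).1) e k q).filter fun i => (z i).2 = true).card) := by
  have hk' : (0 : ℝ) < k := by exact_mod_cast hk
  rw [classifier_eq]
  congr 1
  rw [one_div_mul_eq_div, lt_div_iff₀ hk', eq_iff_iff, ← Nat.cast_lt (α := ℝ)]
  push_cast
  constructor <;> intro h <;> linarith

/-- If discarding a point changes the vote, then that point is one of the nearest neighbours, and
the votes of the others are balanced. -/
lemma balanced_of_classifier_erase_ne {k : ℕ} (hk : 1 ≤ k) {z : Fin n → Obs d}
    {e : Finset (Fin n)} (he : k < e.card) {q : Feature d} {i : Fin n}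
    (h : classifier k z (e.erase i) q ≠ classifier k z e q) :
    i ∈ nearest (fun l => (z l).1) e k q ∧
      (((nearest (fun l => (z l).1) e k q).erase i).filter fun l => (z l).2 = true).card
        = k / 2 := by
  have hi : i ∈ nearest (fun l => (z l).1) e k q := by
    by_contra hi
    exact h (classifier_erase_of_notMem hi)
  refine ⟨hi, ?_⟩
  set S := nearest (fun l => (z l).1) e k q with hS
  set S' := nearest (fun l => (z l).1) (e.erase i) k q with hS'
  have hcard : S.card = k := by rw [hS, card_nearest]; omega
  have hcard' : S'.card = k := by
    rw [hS', card_nearest, Finset.card_erase_of_mem (nearest_subset _ _ _ _ hi)]; omega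
  have hsub : S.erase i ⊆ S' := by
    intro l hl
    obtain ⟨hli, hl⟩ := Finset.mem_erase.1 hl
    have hl' := mem_nearest.1 hl
    exact mem_nearest.2 ⟨Finset.mem_erase.2 ⟨hli, hl'.1⟩, lt_of_le_of_lt
      (Finset.card_le_card (Finset.filter_subset_filter _ (Finset.erase_subset _ _))) hl'.2⟩
  -- Both neighbour sets consist of `S.erase i` and one further index. If c is the number of ones in
  -- `S.erase i`, opposite votes force 2c ≤ k < 2c + 2.
  have hlow : ∀ A : Finset (Fin n), S.erase i ⊆ A → A.card = k →
      ((S.erase i).filter fun l => (z l).2 = true).card ≤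
        (A.filter fun l => (z l).2 = true).card ∧
      (A.filter fun l => (z l).2 = true).card ≤
        ((S.erase i).filter fun l => (z l).2 = true).card + 1 := by
    intro A hA hAc
    refine ⟨Finset.card_le_card (Finset.filter_subset_filter _ hA), ?_⟩
    have h1 : A.filter (fun l => (z l).2 = true) ⊆
        (S.erase i).filter (fun l => (z l).2 = true) ∪ (A \ S.erase i) := by
      intro l hl
      simp only [Finset.mem_filter, Finset.mem_union, Finset.mem_sdiff] at hl ⊢
      by_cases hlS : l ∈ S.erase i
      · exact Or.inl ⟨hlS, hl.2⟩
      · exact Or.inr ⟨hl.1, hlS⟩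
    have h2 : (A \ S.erase i).card = 1 := by
      rw [Finset.card_sdiff_of_subset hA, Finset.card_erase_of_mem hi]; omega
    exact (Finset.card_le_card h1).trans ((Finset.card_union_le _ _).trans_eq (by rw [h2]))
  have h1 := hlow S (Finset.erase_subset _ _) hcard
  have h2 := hlow S' hsub hcard'
  rw [classifier_eq_decide_lt hk, classifier_eq_decide_lt hk, ← hS, ← hS'] at h
  rw [ne_eq, decide_eq_decide] at h
  omega

/-- The event that the points of `S` are closer to the `q`-th point than the `j`-th point is, while
the other points of `e` are further away. -/
def nearestEvent (d : ℕ) (e S : Finset (Fin n)) (q j : Fin n) : Set (Fin n → Obs d) :=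
  {z | (∀ l ∈ S, dist (z l).1 (z q).1 < dist (z j).1 (z q).1) ∧
    ∀ l ∈ e, l ∉ S → l ≠ j → dist (z j).1 (z q).1 < dist (z l).1 (z q).1}

lemma measurableSet_nearestEvent (e S : Finset (Fin n)) (q j : Fin n) :
    MeasurableSet (nearestEvent d e S q j) := by
  have hdist : ∀ l : Fin n, Measurable fun z : Fin n → Obs d => dist (z l).1 (z q).1 := fun l =>
    (measurable_pi_apply l).fst.dist (measurable_pi_apply q).fst
  have : nearestEvent d e S q j = (⋂ l ∈ S, {z | dist (z l).1 (z q).1 < dist (z j).1 (z q).1}) ∩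
      ⋂ l ∈ e.filter fun l => l ∉ S ∧ l ≠ j,
        {z | dist (z j).1 (z q).1 < dist (z l).1 (z q).1} := by
    ext z; simp [nearestEvent]
  rw [this]
  exact (Finset.measurableSet_biInter _ fun l _ => measurableSet_lt (hdist l) (hdist j)).inter
    (Finset.measurableSet_biInter _ fun l _ => measurableSet_lt (hdist j) (hdist l))

/-- The witness has rank exactly k, so it is the (k+1)-th nearest neighbour; without ties the order
of the keys is strict in distance. -/
lemma exists_mem_nearestEvent {z : Fin n → Obs d} (hz : TieFree fun i => (z i).1)
    {e : Finset (Fin n)} {q : Fin n} (hq : q ∉ e) {k : ℕ} (he : k < e.card) :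
    ∃ j ∈ e, j ∉ nearest (fun l => (z l).1) e k (z q).1 ∧
      z ∈ nearestEvent d e (nearest (fun l => (z l).1) e k (z q).1) q j := by
  set x : Fin n → Feature d := fun l => (z l).1 with hx
  obtain ⟨j, hj, hjk⟩ := exists_keyRank_eq (distKey_injective x (z q).1) he
  have hjn : j ∉ nearest x e k (z q).1 := fun h => absurd hjk (mem_nearest.1 h).2.ne
  have hstrict : ∀ a ∈ e, ∀ b ∈ e, distKey x (z q).1 a < distKey x (z q).1 b →
      dist (z a).1 (z q).1 < dist (z b).1 (z q).1 := by
    intro a ha b hb hab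
    rcases closer_iff_distKey.2 hab with h | h
    · exact h
    · exact absurd h.1 (hz q a b (fun h' => hq (h' ▸ ha)) (fun h' => hq (h' ▸ hb)) h.2.ne)
  refine ⟨j, hj, hjn, fun l hl => ?_, fun l hl hln hlj => ?_⟩
  · have hl' := mem_nearest.1 hl
    exact hstrict l hl'.1 j hj ((keyRank_lt_iff hl'.1).1 (hl'.2.trans_eq hjk.symm))
  · refine hstrict j hj l hl (lt_of_le_of_ne ?_ ((distKey_injective x (z q).1).ne hlj.symm))
    by_contra hc
    refine hln (mem_nearest.2 ⟨hl, ?_⟩)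
    rw [← hjk]
    exact keyRank_lt_of_lt hl (not_le.1 hc)

/-- Take the index with the smaller radius: its ball of neighbours lies in the other one, equal
cardinalities make the two sets equal, and then the radii must belong to the same index. -/
lemma nearestEvent_disjoint {e S S' : Finset (Fin n)} {q j j' : Fin n} (hS : S ⊆ e) (hS' : S' ⊆ e)
    (hcard : S.card = S'.card) (hj : j ∈ e) (hj' : j' ∈ e) (hjS : j ∉ S) (hjS' : j' ∉ S')
    (hne : (S, j) ≠ (S', j')) :
    Disjoint (nearestEvent d e S q j) (nearestEvent d e S' q j') := by
  rw [Set.disjoint_left]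
  intro z hz hz'
  have key : ∀ {S S' : Finset (Fin n)} {j j' : Fin n}, S ⊆ e → S.card = S'.card → j ∈ e →
      j ∉ S → (S, j) ≠ (S', j') → z ∈ nearestEvent d e S q j → z ∈ nearestEvent d e S' q j' →
      dist (z j).1 (z q).1 ≤ dist (z j').1 (z q).1 → False := by
    intro S S' j j' hS hcard hj hjS hne hz hz' hle
    have hsub : S ⊆ S' := by
      intro l hl
      by_contra hl'
      have h1 := hz.1 l hl
      by_cases hlj : l = j'
      · subst hlj; linarith
      · have := hz'.2 l (hS hl) hl' hlj; linarith
    have hSS' : S = S' := Finset.eq_of_subset_of_card_le hsub hcard.ge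
    subst hSS'
    have hjj' : j ≠ j' := fun h => hne (by rw [h])
    have := hz'.2 j hj hjS hjj'
    linarith
  rcases le_total (dist (z j).1 (z q).1) (dist (z j').1 (z q).1) with h | h
  · exact key hS hcard hj hjS hne hz hz' h
  · exact key hS' hcard.symm hj' hjS' hne.symm hz' hz h

/-- For T = S \ {i} the event splits into "the points of T are in the ball" and a condition that
ignores the coordinates in T, which is the form needed for conditioning. -/
lemma measureReal_nearestEvent_inter_balanced_le {k : ℕ} (hk : 1 ≤ k) {e S : Finset (Fin n)}
    (hS : S ⊆ e) (hcard : S.card = k) {q j i : Fin n} (hq : q ∉ e) (hj : j ∉ S) (hi : i ∈ S) :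
    (sampleLaw ν n).real (nearestEvent d e S q j ∩
        {z | ((S.erase i).filter fun l => (z l).2 = true).card = k / 2})
      ≤ tieProb k * (sampleLaw ν n).real (nearestEvent d e S q j) := by
  set T := S.erase i with hT
  have hTe : T ⊆ e := (Finset.erase_subset _ _).trans hS
  have hqT : q ∉ T := fun h => hq (hTe h)
  have hjT : j ∉ T := fun h => hj (Finset.mem_of_mem_erase h)
  have hmem : ∀ z : Fin n → Obs d, z ∈ nearestEvent d e S q j ↔
      (∀ l ∈ T, dist (z l).1 (z q).1 < dist (z j).1 (z q).1) ∧
        z ∈ nearestEvent d (e \ T) {i} q j := by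
    intro z
    simp only [nearestEvent, Set.mem_ofPred_eq, Finset.mem_sdiff, Finset.mem_singleton,
      forall_eq, hT, Finset.mem_erase]
    constructor
    · rintro ⟨h1, h2⟩
      exact ⟨fun l hl => h1 l hl.2, h1 i hi, fun l hl hli hlj =>
        h2 l hl.1 (fun hlS => hl.2 ⟨hli, hlS⟩) hlj⟩
    · rintro ⟨h1, h2, h3⟩
      refine ⟨fun l hl => ?_, fun l hl hlS hlj => h3 l ⟨hl, fun h => hlS h.2⟩
        (fun h => hlS (h ▸ hi)) hlj⟩
      by_cases hli : l = i
      · rwa [hli]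
      · exact h1 l ⟨hli, hl⟩
  have h := measureReal_balanced_inter_le (ν := ν) hk (T := T)
    (by rw [hT, Finset.card_erase_of_mem hi, hcard]) hqT hjT
    (measurableSet_nearestEvent (d := d) (e \ T) {i} q j) (by
      intro z z' hzz' hz
      have hiT : i ∉ T := Finset.notMem_erase _ _
      simp only [nearestEvent, Set.mem_ofPred_eq, Finset.mem_singleton, forall_eq,
        ← hzz' i hiT, ← hzz' j hjT, ← hzz' q hqT] at hz ⊢
      refine ⟨hz.1, fun l hl hli hlj => ?_⟩
      rw [← hzz' l (Finset.mem_sdiff.1 hl).2]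
      exact hz.2 l hl hli hlj)
  have h1 : nearestEvent d e S q j =
      {z | ∀ l ∈ T, dist (z l).1 (z q).1 < dist (z j).1 (z q).1} ∩
        nearestEvent d (e \ T) {i} q j := Set.ext hmem
  have h2 : nearestEvent d e S q j ∩ {z | (T.filter fun l => (z l).2 = true).card = k / 2} =
      {z | (∀ l ∈ T, dist (z l).1 (z q).1 < dist (z j).1 (z q).1) ∧
        (T.filter fun l => (z l).2 = true).card = k / 2} ∩ nearestEvent d (e \ T) {i} q j := by
    rw [h1, Set.inter_right_comm]
    rfl
  rw [h2, h1]
  exact h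

/-- The expected number of points of the subsample that change the vote when they are discarded. -/
lemma sum_measureReal_classifier_erase_ne_le (hties : NoDistanceTies (ν.map Prod.fst)) {k : ℕ}
    (hk : 1 ≤ k) {e : Finset (Fin n)} (he : k < e.card) {q : Fin n} (hq : q ∉ e) :
    ∑ i ∈ e, (sampleLaw ν n).real
      {z | classifier k z (e.erase i) (z q).1 ≠ classifier k z e (z q).1} ≤ k * tieProb k := by
  classical
  -- The possible pairs (set of k nearest, (k+1)-th nearest). Their events are disjoint, so their
  -- probabilities sum to at most 1, and each pair contributes its k neighbours.
  set I := (Finset.powersetCard k e ×ˢ e).filter fun a => a.2 ∉ a.1 with hI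
  have hImem : ∀ a ∈ I, a.1 ⊆ e ∧ a.1.card = k ∧ a.2 ∈ e ∧ a.2 ∉ a.1 := by
    intro a ha
    simp only [hI, Finset.mem_filter, Finset.mem_product, Finset.mem_powersetCard] at ha
    exact ⟨ha.1.1.1, ha.1.1.2, ha.1.2, ha.2⟩
  let W : Finset (Fin n) → Fin n → Set (Fin n → Obs d) := fun S i =>
    {z | ((S.erase i).filter fun l => (z l).2 = true).card = k / 2}
  have hsum : ∑ a ∈ I, (sampleLaw ν n).real (nearestEvent d e a.1 q a.2) ≤ 1 := by
    rw [← measureReal_biUnion_finset]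
    · exact measureReal_le_one
    · intro a ha b hb hab
      obtain ⟨h1, h2, h3, h4⟩ := hImem a ha
      obtain ⟨h1', h2', h3', h4'⟩ := hImem b hb
      exact nearestEvent_disjoint h1 h1' (h2.trans h2'.symm) h3 h3' h4 h4' hab
    · exact fun a _ => measurableSet_nearestEvent _ _ _ _
  have hstep : ∀ i ∈ e, (sampleLaw ν n).real
      {z | classifier k z (e.erase i) (z q).1 ≠ classifier k z e (z q).1}
      ≤ ∑ a ∈ I, if i ∈ a.1 then
        (sampleLaw ν n).real (nearestEvent d e a.1 q a.2 ∩ W a.1 i) else 0 := by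
    intro i _
    rw [← Finset.sum_filter]
    refine le_trans ?_ (measureReal_biUnion_finset_le _ _)
    refine ENNReal.toReal_mono (measure_ne_top _ _) (measure_mono_ae ?_)
    filter_upwards [ae_tieFree hties n] with z hz hne
    obtain ⟨j, hj, hjn, hev⟩ := exists_mem_nearestEvent hz hq he
    obtain ⟨hi, hW⟩ := balanced_of_classifier_erase_ne hk he hne
    refine Set.mem_biUnion (x := (nearest (fun l => (z l).1) e k (z q).1, j)) ?_ ⟨hev, hW⟩
    simp only [Finset.coe_filter, Set.mem_ofPred_eq, hI, Finset.mem_filter, Finset.mem_product,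
      Finset.mem_powersetCard]
    refine ⟨⟨⟨⟨nearest_subset _ _ _ _, ?_⟩, hj⟩, hjn⟩, hi⟩
    rw [card_nearest]; omega
  calc _ ≤ ∑ i ∈ e, ∑ a ∈ I, (if i ∈ a.1 then
        (sampleLaw ν n).real (nearestEvent d e a.1 q a.2 ∩ W a.1 i) else 0) :=
        Finset.sum_le_sum hstep
    _ = ∑ a ∈ I, ∑ i ∈ e, (if i ∈ a.1 then
        (sampleLaw ν n).real (nearestEvent d e a.1 q a.2 ∩ W a.1 i) else 0) := Finset.sum_comm
    _ ≤ ∑ a ∈ I, k * tieProb k * (sampleLaw ν n).real (nearestEvent d e a.1 q a.2) := by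
        refine Finset.sum_le_sum fun a ha => ?_
        obtain ⟨h1, h2, -, h4⟩ := hImem a ha
        rw [← Finset.sum_filter, Finset.filter_mem_eq_inter, Finset.inter_eq_right.2 h1]
        refine (Finset.sum_le_card_nsmul _ _ _ fun i hi =>
          measureReal_nearestEvent_inter_balanced_le hk h1 h2 hq h4 hi).trans (le_of_eq ?_)
        rw [h2, nsmul_eq_mul, mul_assoc]
    _ ≤ k * tieProb k * 1 := by
        rw [← Finset.mul_sum]
        exact mul_le_mul_of_nonneg_left hsum
          (mul_nonneg (Nat.cast_nonneg _) (tieProb_nonneg k))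
    _ = _ := mul_one _

lemma abs_integral_loss_sub_le (k : ℕ) (e e' : Finset (Fin n)) (q : Fin n) :
    |∫ z, loss k z e q ∂(sampleLaw ν n) - ∫ z, loss k z e' q ∂(sampleLaw ν n)|
      ≤ (sampleLaw ν n).real {z | classifier k z e' (z q).1 ≠ classifier k z e (z q).1} := by
  have hm : ∀ e : Finset (Fin n), Measurable fun z : Fin n → Obs d => classifier k z e (z q).1 :=
    fun e => measurable_classifier measurable_id (measurable_pi_apply q).fst k e
  have hms : MeasurableSet
      {z : Fin n → Obs d | classifier k z e' (z q).1 ≠ classifier k z e (z q).1} :=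
    (measurableSet_eq_fun (hm e') (hm e)).compl
  rw [← integral_sub (integrable_loss k e q) (integrable_loss k e' q), ← integral_indicator_one hms]
  refine (abs_integral_le_integral_abs).trans (integral_mono
    ((integrable_loss k e q).sub (integrable_loss k e' q)).abs
    ((integrable_const _).indicator hms) fun z => ?_)
  by_cases h : classifier k z e' (z q).1 = classifier k z e (z q).1
  · have : loss k z e q = loss k z e' q := by unfold loss; rw [h]
    simp [this, h]
  · simpa [h] using abs_loss_sub_le_one k

/-- The effect on the risk of adding one observation. -/
lemma abs_integral_loss_succ_sub_le (hties : NoDistanceTies (ν.map Prod.fst)) {k : ℕ}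
    (hk : 1 ≤ k) {e e' : Finset (Fin n)} (he : k < e.card) (hcard : e'.card + 1 = e.card)
    {q : Fin n} (hq : q ∉ e) (hq' : q ∉ e') :
    |∫ z, loss k z e q ∂(sampleLaw ν n) - ∫ z, loss k z e' q ∂(sampleLaw ν n)|
      ≤ k * tieProb k / e.card := by
  have hpos : (0 : ℝ) < e.card := by
    have : 0 < e.card := by omega
    exact_mod_cast this
  rw [le_div_iff₀' hpos]
  refine le_trans ?_ (sum_measureReal_classifier_erase_ne_le (ν := ν) hties hk he hq)
  rw [← nsmul_eq_mul, ← Finset.sum_const]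
  refine Finset.sum_le_sum fun i hi => ?_
  -- Exchangeability replaces `e'` by `e` with any chosen point deleted, so the gap may be summed
  -- over all deletions.
  rw [integral_loss_eq (e := e') (e' := e.erase i) hties k hq'
    (fun h => hq (Finset.mem_of_mem_erase h)) (by rw [Finset.card_erase_of_mem hi]; omega)]
  exact abs_integral_loss_sub_le k e (e.erase i) q

/-- The effect on the risk of discarding several observations, by the union bound. -/
lemma abs_integral_loss_sub_le_of_subset (hties : NoDistanceTies (ν.map Prod.fst)) (k : ℕ)
    {e e' : Finset (Fin n)} (he : e' ⊆ e) {q : Fin n} (hq : q ∉ e) :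
    |∫ z, loss k z e q ∂(sampleLaw ν n) - ∫ z, loss k z e' q ∂(sampleLaw ν n)|
      ≤ (e \ e').card * (k / e.card) := by
  classical
  refine (abs_integral_loss_sub_le k e e' q).trans ?_
  have hsub : {z : Fin n → Obs d | classifier k z e' (z q).1 ≠ classifier k z e (z q).1} ⊆
      ⋃ i ∈ e \ e', {z | i ∈ nearest (fun l => (z l).1) e k (z q).1} := by
    intro z hz
    by_contra hc
    refine hz (classifier_congr_nearest (nearest_eq_of_subset (fun i hi => ?_) he))
    by_contra hi'
    exact hc (Set.mem_biUnion (x := i)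
      (Finset.mem_coe.2 (Finset.mem_sdiff.2 ⟨nearest_subset _ _ _ _ hi, hi'⟩)) hi)
  refine (measureReal_mono hsub (measure_ne_top _ _)).trans
    ((measureReal_biUnion_finset_le _ _).trans ?_)
  rw [← nsmul_eq_mul]
  exact Finset.sum_le_card_nsmul _ _ _ fun i hi =>
    measureReal_mem_nearest_le hties k hq (Finset.mem_sdiff.1 hi).1

variable {p k : ℕ}

/-! ### The bias by telescoping over the sample size. -/

section Bias

lemma sum_one_div_sub_le (hp : 1 ≤ p) (hpn : p ≤ n) (h : (p : ℝ) ≤ n / 2 + 1) :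
    ∑ j ∈ Finset.range p, (1 : ℝ) / (n - j) ≤ 3 / 2 * (p / n) := by
  have hn : (0 : ℝ) < n := by
    have : 0 < n := by omega
    exact_mod_cast this
  have href := Finset.sum_range_reflect (fun j => (1 : ℝ) / (n - j)) p
  -- Pair each term with its mirror image. The product of the denominators is at least n² - n(p -
  -- 1), and the bound then becomes exactly 2p - 2 ≤ n.
  have hpair : ∀ j ∈ Finset.range p,
      (1 : ℝ) / (n - j) + 1 / (n - ((p - 1 - j : ℕ) : ℝ)) ≤ 3 / n := by
    intro j hj
    have hj' := Finset.mem_range.1 hj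
    have hcast : ((p - 1 - j : ℕ) : ℝ) = p - 1 - j := by
      rw [Nat.cast_sub (by omega), Nat.cast_sub hp, Nat.cast_one]
    have h1 : (j : ℝ) + 1 ≤ p := by exact_mod_cast hj'
    have hj0 : (0 : ℝ) ≤ j := Nat.cast_nonneg j
    have hpn' : (p : ℝ) ≤ n := by exact_mod_cast hpn
    rw [hcast]
    have ha : (0 : ℝ) < n - j := by linarith
    have hb : (0 : ℝ) < n - (p - 1 - j) := by linarith
    rw [div_add_div _ _ ha.ne' hb.ne', div_le_div_iff₀ (mul_pos ha hb) hn]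
    nlinarith [mul_nonneg hj0 (sub_nonneg.2 h1), mul_nonneg hn.le (sub_nonneg.2 h)]
  have hsum := Finset.sum_le_sum hpair
  rw [Finset.sum_add_distrib, href, Finset.sum_const, Finset.card_range, nsmul_eq_mul] at hsum
  have : (p : ℝ) * (3 / n) = 3 * (p / n) := by ring
  linarith

lemma three_halves_mul_tieProb_le (hk : 1 ≤ k) (hk2 : k ≠ 2) :
    3 / 2 * (k * tieProb k) ≤ 4 / √(2 * Real.pi) * √k := by
  have hpi : (0 : ℝ) < √(2 * Real.pi) := Real.sqrt_pos.2 (by positivity)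
  have h1 : k * tieProb k ≤ √k := by
    refine Real.le_sqrt_of_sq_le ?_
    have := mul_tieProb_sq_le hk hk2
    nlinarith [(Nat.cast_nonneg k : (0 : ℝ) ≤ k)]
  have h2 : 3 / 2 ≤ 4 / √(2 * Real.pi) := by
    rw [le_div_iff₀ hpi]
    have : √(2 * Real.pi) ≤ 8 / 3 := by
      rw [Real.sqrt_le_left (by norm_num)]
      linarith [Real.pi_lt_d2]
    linarith
  calc 3 / 2 * (k * tieProb k) ≤ 3 / 2 * √k := by gcongr
    _ ≤ _ := mul_le_mul_of_nonneg_right h2 (Real.sqrt_nonneg _)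

lemma two_le_four_div_mul_sqrt_two : (2 : ℝ) ≤ 4 / √(2 * Real.pi) * √2 := by
  have hpi : (0 : ℝ) < √(2 * Real.pi) := Real.sqrt_pos.2 (by positivity)
  rw [div_mul_eq_mul_div, le_div_iff₀ hpi]
  have h : √(2 * Real.pi) ≤ 2 * √2 := by
    rw [Real.sqrt_le_left (by positivity), mul_pow, Real.sq_sqrt (by norm_num)]
    linarith [Real.pi_lt_four]
  linarith

/-- The risks of the classifiers built from `n` and from `n - p` observations are close. -/
theorem abs_integral_loss_sub_le_sqrt {N : ℕ} (hties : NoDistanceTies (ν.map Prod.fst))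
    (hp : 1 ≤ p) (hk : 1 ≤ k) (hpk : p + k ≤ n) (hpn : (p : ℝ) ≤ (n : ℝ) / 2 + 1)
    {e e' : Finset (Fin N)} (he : e.card = n) (he' : e'.card = n - p) {q : Fin N} (hq : q ∉ e)
    (hq' : q ∉ e') :
    |∫ z, loss k z e q ∂(sampleLaw ν N) - ∫ z, loss k z e' q ∂(sampleLaw ν N)|
      ≤ 4 / √(2 * Real.pi) * (p * √k / n) := by
  classical
  have hn : (0 : ℝ) < n := by
    have : 0 < n := by omega
    exact_mod_cast this
  -- The chosen subsets need not be nested, since only their sizes matter for the expected loss.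
  have hex : ∀ m, ∃ s ⊆ e, s.card = min m n := fun m =>
    Finset.exists_subset_card_eq (by rw [he]; exact min_le_right _ _)
  choose E hE hEc using hex
  have hqE : ∀ m, q ∉ E m := fun m h => hq (hE m h)
  have hp0 : ∫ z, loss k z e' q ∂(sampleLaw ν N) = ∫ z, loss k z (E (n - p)) q ∂(sampleLaw ν N) :=
    integral_loss_eq hties k hq' (hqE _) (by rw [hEc, he']; omega)
  rw [hp0]
  -- Here `tieProb 2 = 1`, and telescoping would give 3p/n, more than the allowed 4√2/√(2π) · p/n ≈
  -- 2.26 p/n. The union bound gives 2p/n.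
  by_cases hk2 : k = 2
  · subst hk2
    refine (abs_integral_loss_sub_le_of_subset hties 2 (hE (n - p)) hq).trans ?_
    have hc : (e \ E (n - p)).card = p := by
      rw [Finset.card_sdiff_of_subset (hE _), hEc, he]; omega
    rw [hc, he]
    have := mul_le_mul_of_nonneg_right two_le_four_div_mul_sqrt_two
      (by positivity : (0 : ℝ) ≤ p / n)
    push_cast
    calc (p : ℝ) * (2 / n) = 2 * (p / n) := by ring
      _ ≤ 4 / √(2 * Real.pi) * √2 * (p / n) := this
      _ = _ := by ring
  · set r : ℕ → ℝ := fun j => ∫ z, loss k z (E (n - j)) q ∂(sampleLaw ν N) with hr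
    have h0 : ∫ z, loss k z e q ∂(sampleLaw ν N) = r 0 :=
      integral_loss_eq hties k hq (hqE _) (by rw [hEc, he]; omega)
    rw [h0]
    change |r 0 - r p| ≤ _
    rw [← Finset.sum_range_sub']
    have hstep : ∀ j ∈ Finset.range p, |r j - r (j + 1)| ≤ k * tieProb k * (1 / (n - j)) := by
      intro j hj
      have hj' := Finset.mem_range.1 hj
      have hcj : (E (n - j)).card = n - j := by rw [hEc]; omega
      have := abs_integral_loss_succ_sub_le (ν := ν) hties hk (e := E (n - j))
        (e' := E (n - (j + 1))) (by omega) (by rw [hcj, hEc]; omega) (hqE _) (hqE _)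
      rw [hcj, Nat.cast_sub (by omega)] at this
      rwa [mul_one_div]
    have hkt : 0 ≤ k * tieProb k := mul_nonneg (Nat.cast_nonneg _) (tieProb_nonneg k)
    calc |∑ j ∈ Finset.range p, (r j - r (j + 1))|
        ≤ ∑ j ∈ Finset.range p, k * tieProb k * ((1 : ℝ) / (n - j)) :=
          (Finset.abs_sum_le_sum_abs _ _).trans (Finset.sum_le_sum hstep)
      _ ≤ k * tieProb k * (3 / 2 * (p / n)) := by
          rw [← Finset.mul_sum]
          exact mul_le_mul_of_nonneg_left (sum_one_div_sub_le hp (by omega) hpn) hkt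
      _ = 3 / 2 * (k * tieProb k) * (p / n) := by ring
      _ ≤ 4 / √(2 * Real.pi) * √k * (p / n) :=
          mul_le_mul_of_nonneg_right (three_halves_mul_tieProb_le hk hk2) (by positivity)
      _ = _ := by ring

end Bias

/-! ### The risk and the mean of the estimator as expected losses. -/

section Expectation

lemma measurable_classificationError (n k : ℕ) : Measurable fun z : Fin n → Obs d =>
    classificationError ν (classifier k z Finset.univ) := by
  have hms : MeasurableSet
      {w : (Fin n → Obs d) × Obs d | classifier k w.1 Finset.univ w.2.1 ≠ w.2.2} :=
    (measurableSet_eq_fun (measurable_classifier measurable_fst measurable_snd.fst k _)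
      measurable_snd.snd).compl
  exact (measurable_measure_prodMk_left hms).ennreal_toReal

/-- The mean classification error is an expected loss, the query being an additional observation. -/
lemma integral_classificationError (n k : ℕ) :
    ∫ z, classificationError ν (classifier k z Finset.univ) ∂(sampleLaw ν n) =
      ∫ z, loss k z (Finset.univ.map Fin.castSuccEmb) (Fin.last n) ∂(sampleLaw ν (n + 1)) := by
  set E := (MeasurableEquiv.piFinSuccAbove (fun _ : Fin (n + 1) => Obs d) (Fin.last n)).symm with hE
  have he : MeasurePreserving E (ν.prod (sampleLaw ν n)) (sampleLaw ν (n + 1)) :=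
    (measurePreserving_piFinSuccAbove (fun _ : Fin (n + 1) => ν) (Fin.last n)).symm
  have hEl : ∀ w, E w (Fin.last n) = w.1 := fun w => by
    simp [hE, MeasurableEquiv.piFinSuccAbove, Fin.insertNthEquiv]
  have hEc : ∀ w l, E w (Fin.castSuccEmb l) = w.2 l := fun w l => by
    simp [hE, MeasurableEquiv.piFinSuccAbove, Fin.insertNthEquiv]
  have hloss : ∀ w, loss k (E w) (Finset.univ.map Fin.castSuccEmb) (Fin.last n) =
      {w : Obs d × (Fin n → Obs d) | classifier k w.2 Finset.univ w.1.1 ≠ w.1.2}.indicator 1 w := by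
    intro w
    have hc : classifier k (E w) (Finset.univ.map Fin.castSuccEmb) w.1.1
        = classifier k w.2 Finset.univ w.1.1 := by
      rw [classifier_map (φ := Fin.castSuccEmb) (z := E w) fun i _ j _ =>
        closer_comp_iff_of_strictMono (φ := Fin.castSuccEmb) Fin.strictMono_castSucc
          (fun l => (E w l).1) w.1.1 j i]
      simp only [hEc]
    unfold loss
    rw [hEl, hc]
    simp only [Set.indicator_apply, Set.mem_ofPred_eq, Pi.one_apply]
  have hms : MeasurableSet
      {w : Obs d × (Fin n → Obs d) | classifier k w.2 Finset.univ w.1.1 ≠ w.1.2} :=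
    (measurableSet_eq_fun (measurable_classifier measurable_snd measurable_fst.fst k _)
      measurable_fst.snd).compl
  rw [← he.integral_comp']
  simp only [hloss]
  have hint : Integrable ({w : Obs d × (Fin n → Obs d) |
      classifier k w.2 Finset.univ w.1.1 ≠ w.1.2}.indicator (1 : Obs d × (Fin n → Obs d) → ℝ))
      (ν.prod (sampleLaw ν n)) := (integrable_const (1 : ℝ)).indicator hms
  rw [integral_prod_symm _ hint]
  refine integral_congr_ae (Filter.Eventually.of_forall fun z => ?_)
  have hmz : MeasurableSet {o : Obs d | classifier k z Finset.univ o.1 ≠ o.2} :=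
    measurable_prodMk_right hms
  exact (integral_indicator_one hmz).symm

/-- Every term is the loss at a point outside a training set of size n - p. Embedding the sample in
one of size n + 1 gives it the same query, the last observation, as the risk. -/
lemma integral_leavePOut (hties : NoDistanceTies (ν.map Prod.fst)) (hp : 1 ≤ p) (hpn : p ≤ n)
    {e' : Finset (Fin (n + 1))} (he' : e'.card = n - p) (hq : Fin.last n ∉ e') :
    ∫ z, leavePOut p k z ∂(sampleLaw ν n) =
      ∫ z, loss k z e' (Fin.last n) ∂(sampleLaw ν (n + 1)) := by
  have hterm : ∀ e ∈ Finset.powersetCard (n - p) (Finset.univ : Finset (Fin n)), ∀ i ∈ eᶜ,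
      ∫ z, loss k z e i ∂(sampleLaw ν n) =
        ∫ z, loss k z e' (Fin.last n) ∂(sampleLaw ν (n + 1)) := by
    intro e he i hi
    have hi' := Finset.mem_compl.1 hi
    rw [← integral_loss_map hties k Fin.castSuccEmb hi']
    refine integral_loss_eq hties k (by simpa using hi') hq ?_
    rw [Finset.card_map, he', (Finset.mem_powersetCard_univ).1 he]
  have hchoose : ((n.choose p : ℝ) * p) ≠ 0 := by
    have := Nat.choose_pos hpn
    positivity
  simp only [leavePOut_eq_sum_loss]
  rw [integral_const_mul, integral_finsetSum _ fun e _ => integrable_finsetSum _ fun i _ =>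
    integrable_loss k e i]
  have hinner : ∀ e ∈ Finset.powersetCard (n - p) (Finset.univ : Finset (Fin n)),
      ∫ z, ∑ i ∈ eᶜ, loss k z e i ∂(sampleLaw ν n) =
        p * ∫ z, loss k z e' (Fin.last n) ∂(sampleLaw ν (n + 1)) := by
    intro e he
    rw [integral_finsetSum _ fun i _ => integrable_loss k e i,
      Finset.sum_congr rfl (hterm e he), Finset.sum_const, nsmul_eq_mul, Finset.card_compl,
      (Finset.mem_powersetCard_univ).1 he, Fintype.card_fin]
    congr 2
    omega
  rw [Finset.sum_congr rfl hinner, Finset.sum_const, Finset.card_powersetCard, Finset.card_univ,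
    Fintype.card_fin, Nat.choose_symm hpn, nsmul_eq_mul, ← mul_assoc, ← mul_assoc,
    mul_assoc _ (n.choose p : ℝ), inv_mul_cancel₀ hchoose, one_mul]

lemma abs_leavePOut_le_one (hp : 1 ≤ p) (hpn : p ≤ n) (z : Fin n → Obs d) :
    |leavePOut p k z| ≤ 1 := by
  have hchoose : (0 : ℝ) < (n.choose p : ℝ) * p := by
    have := Nat.choose_pos hpn
    positivity
  rw [leavePOut_eq_sum_loss, abs_of_nonneg (mul_nonneg (inv_pos.2 hchoose).le
    (Finset.sum_nonneg fun e _ => Finset.sum_nonneg fun i _ => loss_nonneg k z e i)),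
    inv_mul_le_one₀ hchoose]
  have hinner : ∀ e ∈ Finset.powersetCard (n - p) (Finset.univ : Finset (Fin n)),
      ∑ i ∈ eᶜ, loss k z e i ≤ p := by
    intro e he
    refine (Finset.sum_le_card_nsmul _ _ 1 fun i _ => loss_le_one k z e i).trans (le_of_eq ?_)
    rw [nsmul_eq_mul, mul_one, Finset.card_compl, (Finset.mem_powersetCard_univ).1 he,
      Fintype.card_fin]
    congr 1
    omega
  refine (Finset.sum_le_card_nsmul _ _ _ hinner).trans (le_of_eq ?_)
  rw [Finset.card_powersetCard, Finset.card_univ, Fintype.card_fin, Nat.choose_symm hpn,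
    nsmul_eq_mul]

end Expectation

/-! ### Comparison of the constants and conclusion. -/

lemma one_half_le_kappa : 1 / 2 ≤ kappa := by
  have h : 1 < √(Real.exp 1) := by
    rw [Real.lt_sqrt zero_le_one]
    simp
  unfold kappa
  rw [div_le_div_iff₀ (by norm_num) (by linarith)]
  linarith

/-- The McDiarmid constant is dominated by Δ: k ≥ 1 factors out k, and 2(1 + 2γ)² is bounded through
C₁ = 2 + 16γ and C₂² ≥ 16γ², the latter from κ ≥ 1/2. -/
lemma two_mul_sq_le_constDelta_sq (hk : 1 ≤ k) :
    2 * (1 + 2 * (k * stoneConst d)) ^ 2 ≤ constDelta d ^ 2 * (k : ℝ) ^ 2 := by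
  set γ := stoneConst d with hγ
  have hγ0 : 0 ≤ γ := stoneConst_nonneg d
  have hk' : (1 : ℝ) ≤ k := by exact_mod_cast hk
  set M := max (constC₂ d) √(constC₁ d) with hM
  have hM1 : 2 + 16 * γ ≤ M ^ 2 := by
    have h : 0 ≤ constC₁ d := by unfold constC₁; positivity
    calc 2 + 16 * γ = √(constC₁ d) ^ 2 := by rw [Real.sq_sqrt h]; rfl
      _ ≤ M ^ 2 := pow_le_pow_left₀ (Real.sqrt_nonneg _) (le_max_right _ _) 2
  have hM2 : 16 * γ ^ 2 ≤ M ^ 2 := by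
    have hκ := one_half_le_kappa
    have h : constC₂ d ^ 2 = 16 * γ ^ 2 * (2 * kappa) := by
      unfold constC₂
      rw [mul_pow, Real.sq_sqrt (by linarith), ← hγ]; ring
    have h0 : 0 ≤ constC₂ d := by unfold constC₂; positivity
    calc 16 * γ ^ 2 ≤ 16 * γ ^ 2 * (2 * kappa) :=
          le_mul_of_one_le_right (by positivity) (by linarith)
      _ = constC₂ d ^ 2 := h.symm
      _ ≤ M ^ 2 := pow_le_pow_left₀ h0 (le_max_left _ _) 2
  have hΔ : constDelta d ^ 2 = 16 * Real.exp 1 * M ^ 2 := by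
    unfold constDelta
    rw [← hM, mul_pow, mul_pow, Real.sq_sqrt (Real.exp_pos _).le]; norm_num
  have hexp : 1 ≤ Real.exp 1 := Real.one_le_exp zero_le_one
  have hΔ' : 16 * M ^ 2 ≤ constDelta d ^ 2 := by
    rw [hΔ]; nlinarith [sq_nonneg M]
  have h1 : 1 + 2 * (k * γ) ≤ k * (1 + 2 * γ) := by nlinarith
  calc 2 * (1 + 2 * (k * γ)) ^ 2 ≤ 2 * (k * (1 + 2 * γ)) ^ 2 := by gcongr
    _ = (2 * (1 + 2 * γ) ^ 2) * (k : ℝ) ^ 2 := by ring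
    _ ≤ constDelta d ^ 2 * (k : ℝ) ^ 2 := by
        refine mul_le_mul_of_nonneg_right (le_trans ?_ hΔ') (sq_nonneg _)
        nlinarith

end KNN

theorem mainTheorem8 {d n p k : ℕ} (hp : 1 ≤ p) (hk : 1 ≤ k) (hpk : p + k ≤ n)
    (hpn : (p : ℝ) ≤ (n : ℝ) / 2 + 1)
    {Ω : Type*} [MeasurableSpace Ω] (P : Measure Ω) [IsProbabilityMeasure P]
    (ν : Measure (KNN.Obs d)) [IsProbabilityMeasure ν]
    (hties : KNN.NoDistanceTies (ν.map Prod.fst))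
    (Z : Fin n → Ω → KNN.Obs d) (hZ : ∀ i, Measurable (Z i))
    (hindep : iIndepFun Z P) (hlaw : ∀ i, P.map (Z i) = ν)
    (x : ℝ) (hx : 0 < x) :
    ∃ A : Set Ω, MeasurableSet A ∧ 1 - 2 * Real.exp (-x) ≤ P.real A ∧
      ∀ ω ∈ A,
        |KNN.risk P ν Z k - KNN.leavePOut p k (fun i => Z i ω)| ≤
          √(KNN.constDelta d ^ 2 * (k : ℝ) ^ 2 / ((n : ℝ) - (p : ℝ) + 1) * x)
            + 4 / √(2 * Real.pi) * ((p : ℝ) * √(k : ℝ) / (n : ℝ)) := by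
  have hn : 0 < n := by omega
  have hn' : (0 : ℝ) < n := by exact_mod_cast hn
  have hp' : (1 : ℝ) ≤ p := by exact_mod_cast hp
  have hple : (p : ℝ) ≤ n := by exact_mod_cast (by omega : p ≤ n)
  have hZm : Measurable fun ω i => Z i ω := measurable_pi_lambda _ hZ
  have hmap : P.map (fun ω i => Z i ω) = KNN.sampleLaw ν n := by
    rw [(iIndepFun_iff_map_fun_eq_pi_map fun i => (hZ i).aemeasurable).1 hindep]
    simp only [hlaw]
  have hpres : MeasurePreserving (fun ω i => Z i ω) P (KNN.sampleLaw ν n) := ⟨hZm, hmap⟩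
  set m := ∫ z, KNN.leavePOut p k z ∂(KNN.sampleLaw ν n) with hm
  set c := (1 + 2 * (k * KNN.stoneConst d)) / (n : ℝ) with hc
  have hγ := KNN.stoneConst_nonneg d
  have hc0 : 0 < c := by positivity
  have htail := KNN.measureReal_abs_sub_integral_gt_le ν n (KNN.leavePOut p k)
    (KNN.measurable_leavePOut p k) (KNN.abs_leavePOut_le_one hp (by omega))
    {z | KNN.TieFree fun i => (z i).1} (KNN.ae_tieFree hties n)
    (fun j z hz z' hz' h => KNN.abs_leavePOut_sub_le hp hk (by omega) hz hz' h) hn hc0 hx.le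
  have hrisk : |KNN.risk P ν Z k - m| ≤ 4 / √(2 * Real.pi) * ((p : ℝ) * √(k : ℝ) / (n : ℝ)) := by
    obtain ⟨e', he's, he'⟩ := Finset.exists_subset_card_eq
      (s := (Finset.univ : Finset (Fin n)).map Fin.castSuccEmb) (n := n - p) (by simp)
    have hq : Fin.last n ∉ (Finset.univ : Finset (Fin n)).map Fin.castSuccEmb := by
      simp
    have hq' : Fin.last n ∉ e' := fun h => hq (he's h)
    have hr : KNN.risk P ν Z k = ∫ z, KNN.classificationError ν
        (KNN.classifier k z Finset.univ) ∂(KNN.sampleLaw ν n) := by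
      rw [← hmap]
      exact (integral_map hZm.aemeasurable
        (KNN.measurable_classificationError n k).aestronglyMeasurable).symm
    rw [hr, KNN.integral_classificationError, hm,
      KNN.integral_leavePOut hties hp (by omega) he' hq']
    exact KNN.abs_integral_loss_sub_le_sqrt hties hp hk hpk hpn (by simp) he' hq hq'
  set A : Set (Fin n → KNN.Obs d) :=
    {z | √(2 * n * c ^ 2 * x) < |KNN.leavePOut p k z - m|} with hA
  have hAm : MeasurableSet A := measurableSet_lt measurable_const
    ((KNN.measurable_leavePOut p k).sub measurable_const).abs
  refine ⟨(fun ω i => Z i ω) ⁻¹' Aᶜ, hZm hAm.compl, ?_, fun ω hω => ?_⟩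
  · rw [hpres.measureReal_preimage hAm.compl.nullMeasurableSet, probReal_compl_eq_one_sub hAm]
    linarith
  · have hω' : |KNN.leavePOut p k (fun i => Z i ω) - m| ≤ √(2 * n * c ^ 2 * x) := not_lt.1 hω
    have hsqrt : √(2 * n * c ^ 2 * x) ≤
        √(KNN.constDelta d ^ 2 * (k : ℝ) ^ 2 / ((n : ℝ) - (p : ℝ) + 1) * x) := by
      refine Real.sqrt_le_sqrt (mul_le_mul_of_nonneg_right ?_ hx.le)
      calc 2 * n * c ^ 2 = 2 * (1 + 2 * (k * KNN.stoneConst d)) ^ 2 / n := by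
            rw [hc, div_pow]; field_simp
        _ ≤ KNN.constDelta d ^ 2 * (k : ℝ) ^ 2 / n := by
            exact div_le_div_of_nonneg_right (KNN.two_mul_sq_le_constDelta_sq hk) hn'.le
        -- McDiarmid yields the denominator n; as p ≥ 1, passing to n - p + 1 only weakens the
        -- bound.
        _ ≤ _ := by
            refine div_le_div_of_nonneg_left (by positivity) (by linarith) (by linarith)
    calc _ = |(KNN.risk P ν Z k - m) - (KNN.leavePOut p k (fun i => Z i ω) - m)| := by ring_nf
      _ ≤ |KNN.risk P ν Z k - m| + |KNN.leavePOut p k (fun i => Z i ω) - m| := abs_sub _ _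
      _ ≤ _ := by linarith
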